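/- Let $d\ge 1$, let $H_1,\dots,H_d$ be Hermitian operators on $\mathbb C^D$ and put $U_\theta=\exp\big(i\sum_{j=1}^d\theta_jH_j\big)$ for $\theta\in\mathbb R^d$. Let $|\psi\rangle=D^{-1/2}\sum_{i=1}^D|e_i\rangle\otimes|f_i\rangle$ be a maximally entangled vector of $\mathbb C^D\otimes\mathbb C^D$, where $(e_i)$ and $(f_i)$ are orthonormal bases of $\mathbb C^D$ (for example $|\psi\rangle=D^{-1/2}\sum_i|i\rangle\otimes|i\rangle$), and let $\rho_\theta=|\psi_\theta\rangle\langle\psi_\theta|$, where either $|\psi_\theta\rangle=(\mathbb 1\otimes U_\theta)|\psi\rangle$ for all $\theta$, or $|\psi_\theta\rangle=(U_\theta\otimes U_\theta)|\psi\rangle$ for all $\theta$. Let $\Theta\subseteq\mathbb R^d$ be open and $\theta\in\Theta$. Symmetric logarithmic derivatives of the model at $\theta$ are Hermitian operators $L_1,\dots,L_d$ with $\partial\rho_\theta/\partial\theta_i=\tfrac12(\rho_\theta L_i+L_i\rho_\theta)$. Given such operators, let $$F_{ij}(\theta)=\tfrac12\operatorname{Tr}\big[\rho_\theta(L_iL_j+L_jL_i)\big],\qquad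 A_{ij}(\theta)=\tfrac1{2i}\operatorname{Tr}\big[\rho_\theta[L_i,L_j]\big].$$ For $N\ge1$ let $\mathcal M_N$ be the set of POVMs $M$ on $N$ copies of the system, with outcome $\hat\theta\in\Theta$ distributed according to the Born rule for $\rho_\theta^{\otimes N}$, that are locally unbiased at $\theta$: the bias $b_i(\eta)=\mathbb E_\eta[\hat\theta_i]-\eta_i$ is defined for $\eta$ near $\theta$, the bias and all its first partial derivatives vanish at $\eta=\theta$, and the mean square error matrix $\Sigma_{ij}(\theta)=\mathbb E_\theta[(\hat\theta_i-\theta_i)(\hat\theta_j-\theta_j)]$ is finite. When $F(\theta)$ is non-singular, put $$r_N(\theta)=\inf_{M\in\mathcal M_N}\ \sup_{G\ge0,\,G\ne0}\frac{N\operatorname{Tr}[G\,\Sigma(\theta)]}{\operatorname{Tr}[G\,F(\theta)^{-1}]},\qquad \mathcal I(\theta)=\liminf_{N\to\infty}r_N(\theta)-1$$ ($G$ ranges over real positive semidefinite $d\times d$ matrices; the infimum over the empty set is $+\infty$). Then symmetric logarithmic derivatives at $\theta$ exist, and for every choice of them $A(\theta)=0$ and, if $F(\theta)>0$, $\mathcal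 I(\theta)=0$. That is, for both evolutions the model is fully compatible at every $\theta$ at which the quantum Fisher information matrix is non-singular. -/

import Mathlib

open Matrix MeasureTheory Filter Topology
open scoped Kronecker ComplexOrder

noncomputable section

namespace QEstimation

section General

variable {Ω : Type*} [MeasurableSpace Ω] {n : Type*} [Fintype n] [DecidableEq n]

/-- A positive operator valued measure with outcomes in the measurable space `Ω`, acting on the
Hilbert space `ℂⁿ`: a countably additive map from the measurable subsets of `Ω` to positive
semidefinite matrices, normalised to the identity. -/
structure POVM (Ω : Type*) [MeasurableSpace Ω] (n : Type*) [Fintype n] [DecidableEq n] where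
  effect : VectorMeasure Ω (Matrix n n ℂ)
  posSemidef : ∀ B : Set Ω, (effect B).PosSemidef
  effect_univ : effect Set.univ = 1

open scoped MatrixOrder in
theorem exists_eq_conjTranspose_mul_self {ρ : Matrix n n ℂ} (hρ : ρ.PosSemidef) :
    ∃ B : Matrix n n ℂ, ρ = Bᴴ * B := by
  obtain ⟨X, hX, -, h⟩ :=
    CFC.exists_sqrt_of_isSelfAdjoint_of_quasispectrumRestricts hρ.isHermitian
      (QuasispectrumRestricts.nnreal_of_nonneg hρ.nonneg)
  exact ⟨X, by rw [← h, ← Matrix.star_eq_conjTranspose, hX.star_eq]⟩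

theorem re_trace_mul_nonneg {E ρ : Matrix n n ℂ} (hE : E.PosSemidef) (hρ : ρ.PosSemidef) :
    0 ≤ (E * ρ).trace.re := by
  obtain ⟨B, rfl⟩ := exists_eq_conjTranspose_mul_self hρ
  rw [← Matrix.mul_assoc, Matrix.trace_mul_comm, ← Matrix.mul_assoc]
  exact (Complex.le_def.mp (hE.mul_mul_conjTranspose_same B).trace_nonneg).1

/-- The distribution of the outcome of the measurement `M` on the state `ρ`, given by the Born
rule `B ↦ Tr [E(B) ρ]`. -/
def POVM.born (M : POVM Ω n) (ρ : Matrix n n ℂ) (hρ : ρ.PosSemidef) : Measure Ω :=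
  Measure.ofMeasurable (fun B _ => ENNReal.ofReal (M.effect B * ρ).trace.re)
    (by simp)
    (by
      intro f hf hd
      have h1 := M.effect.m_iUnion hf hd
      let T : Matrix n n ℂ →+ ℝ :=
        { toFun := fun X => (X * ρ).trace.re
          map_zero' := by simp
          map_add' := by intro X Y; simp [Matrix.add_mul] }
      have hT : Continuous T := by
        change Continuous fun X : Matrix n n ℂ => (X * ρ).trace.re
        fun_prop
      have h2 : HasSum (fun i => (M.effect (f i) * ρ).trace.re)
          (M.effect (⋃ i, f i) * ρ).trace.re := h1.map T hT
      rw [← h2.tsum_eq]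
      exact ENNReal.ofReal_tsum_of_nonneg
        (fun i => re_trace_mul_nonneg (M.posSemidef _) hρ) h2.summable)

/-- The state `ρ ⊗ ⋯ ⊗ ρ` of `N` copies of a system in the state `ρ`. -/
def tensorPow (N : ℕ) (ρ : Matrix n n ℂ) : Matrix (Fin N → n) (Fin N → n) ℂ :=
  Matrix.of fun x y => ∏ k, ρ (x k) (y k)

theorem tensorPow_posSemidef (N : ℕ) {ρ : Matrix n n ℂ} (hρ : ρ.PosSemidef) :
    (tensorPow N ρ).PosSemidef := by
  obtain ⟨B, rfl⟩ := exists_eq_conjTranspose_mul_self hρ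
  have h : tensorPow N (Bᴴ * B) = (tensorPow N B)ᴴ * tensorPow N B := by
    ext x y
    simp only [tensorPow, Matrix.of_apply, Matrix.mul_apply, Matrix.conjTranspose_apply,
      Finset.prod_univ_sum, Fintype.piFinset_univ, star_prod, Finset.prod_mul_distrib]
  rw [h]
  exact Matrix.posSemidef_conjTranspose_mul_self _

variable {d : ℕ}

/-- `L 0, …, L (d - 1)` are symmetric logarithmic derivatives at `θ` of the family of states
`ρ`: they are Hermitian and `∂ρ/∂θ_i = (ρ L_i + L_i ρ) / 2` at `θ` (entry by entry). -/
def IsSLD (ρ : (Fin d → ℝ) → Matrix n n ℂ) (θ : Fin d → ℝ) (L : Fin d → Matrix n n ℂ) : Prop :=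
  ∀ i, (L i).IsHermitian ∧
    ∀ a b, HasDerivAt (fun t : ℝ => ρ (θ + t • Pi.single i 1) a b)
      (((1 / 2 : ℂ) • (ρ θ * L i + L i * ρ θ)) a b) 0

/-- The quantum Fisher information matrix `F_ij = Tr [ρ (L_i L_j + L_j L_i)] / 2` (the trace is
real for Hermitian `ρ` and `L`). -/
def qfi (ρ : Matrix n n ℂ) (L : Fin d → Matrix n n ℂ) : Matrix (Fin d) (Fin d) ℝ :=
  Matrix.of fun i j => (1 / 2) * (ρ * (L i * L j + L j * L i)).trace.re

/-- The commutator matrix `A_ij = Tr [ρ [L_i, L_j]] / (2 i)`. -/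
def commutatorMatrix (ρ : Matrix n n ℂ) (L : Fin d → Matrix n n ℂ) :
    Matrix (Fin d) (Fin d) ℂ :=
  Matrix.of fun i j => 1 / (2 * Complex.I) * (ρ * (L i * L j - L j * L i)).trace

variable (Θ : Set (Fin d → ℝ)) (ρ : (Fin d → ℝ) → Matrix n n ℂ) (hρ : ∀ θ, (ρ θ).PosSemidef)

/-- The distribution `P(· | θ)` of the estimator when `M` is performed on `N` copies of `ρ θ`. -/
def outcomeLaw (N : ℕ) (M : POVM Θ (Fin N → n)) (θ : Fin d → ℝ) : Measure Θ :=
  M.born (tensorPow N (ρ θ)) (tensorPow_posSemidef N (hρ θ))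

/-- The `i`-th component of the bias, `b_i(θ) = E[θ̂_i] - θ_i`. -/
def bias (N : ℕ) (M : POVM Θ (Fin N → n)) (i : Fin d) (θ : Fin d → ℝ) : ℝ :=
  (∫ x : Θ, (x : Fin d → ℝ) i ∂(outcomeLaw Θ ρ hρ N M θ)) - θ i

/-- The mean square error matrix `Σ_ij(θ) = E[(θ̂_i - θ_i) (θ̂_j - θ_j)]`. -/
def mse (N : ℕ) (M : POVM Θ (Fin N → n)) (θ : Fin d → ℝ) : Matrix (Fin d) (Fin d) ℝ :=
  Matrix.of fun i j =>
    ∫ x : Θ, ((x : Fin d → ℝ) i - θ i) * ((x : Fin d → ℝ) j - θ j) ∂(outcomeLaw Θ ρ hρ N M θ)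

/-- `M` is locally unbiased at `θ₀`: the bias vanishes at `θ₀` together with its partial
derivatives. The first two fields say that the bias is defined around `θ₀` and that the mean
square error at `θ₀` is finite. -/
structure LocallyUnbiased (N : ℕ) (M : POVM Θ (Fin N → n)) (θ₀ : Fin d → ℝ) : Prop where
  integrable_nhds : ∀ᶠ θ in 𝓝 θ₀, ∀ i,
    Integrable (fun x : Θ => (x : Fin d → ℝ) i) (outcomeLaw Θ ρ hρ N M θ)
  integrable_sq : ∀ i,
    Integrable (fun x : Θ => ((x : Fin d → ℝ) i - θ₀ i) ^ 2) (outcomeLaw Θ ρ hρ N M θ₀)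
  bias_eq_zero : ∀ i, bias Θ ρ hρ N M i θ₀ = 0
  deriv_bias : ∀ i j,
    HasDerivAt (fun t : ℝ => bias Θ ρ hρ N M i (θ₀ + t • Pi.single j 1)) 0 0

/-- The figure of merit for `N` probes,
`r_N(θ) = inf_M sup_G  N Tr [G Σ(θ)] / Tr [G F(θ)⁻¹]`, where `M` ranges over the measurements on
`N` copies that are locally unbiased at `θ` and `G` over the nonzero positive semidefinite weight
matrices. `L` are the symmetric logarithmic derivatives at `θ`, which enter through `F(θ)`. -/
def figureOfMerit (L : Fin d → Matrix n n ℂ) (N : ℕ) (θ : Fin d → ℝ) : EReal :=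
  ⨅ (M : POVM Θ (Fin N → n)) (_ : LocallyUnbiased Θ ρ hρ N M θ),
    ⨆ (G : Matrix (Fin d) (Fin d) ℝ) (_ : G.PosSemidef ∧ G ≠ 0),
      (((N * (G * mse Θ ρ hρ N M θ).trace) / (G * (qfi (ρ θ) L)⁻¹).trace : ℝ) : EReal)

/-- The incompatibility measure `I(θ) = liminf_N r_N(θ) - 1`. -/
def incompatibility (L : Fin d → Matrix n n ℂ) (θ : Fin d → ℝ) : EReal :=
  liminf (fun N : ℕ => figureOfMerit Θ ρ hρ L N θ) atTop - 1

end General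

/-- The projector `|φ⟩⟨φ|`. -/
def pureState {n : Type*} (φ : n → ℂ) : Matrix n n ℂ := Matrix.vecMulVec φ (star φ)

theorem pureState_posSemidef {n : Type*} [Fintype n] (φ : n → ℂ) : (pureState φ).PosSemidef :=
  Matrix.posSemidef_vecMulVec_self_star φ

/-- The unitary encoding `U_θ = exp (i ∑ θ_j H_j)`. -/
def unitaryEncoding {d D : ℕ} (H : Fin d → Matrix (Fin D) (Fin D) ℂ) (θ : Fin d → ℝ) :
    Matrix (Fin D) (Fin D) ℂ :=
  NormedSpace.exp (Complex.I • ∑ j, (θ j : ℂ) • H j)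

/-- `ψ ∈ ℂᴰ ⊗ ℂᴰ` is maximally entangled: `ψ = D^(-1/2) ∑ i, e_i ⊗ f_i` for some orthonormal
bases `e` and `f` of `ℂᴰ`. -/
def IsMaximallyEntangled {D : ℕ} (ψ : Fin D × Fin D → ℂ) : Prop :=
  ∃ e f : OrthonormalBasis (Fin D) ℂ (EuclideanSpace ℂ (Fin D)),
    ∀ a b, ψ (a, b) = (1 / (Real.sqrt D : ℂ)) * ∑ i, e i a * f i b

end QEstimation

end

/-! Both reduced states of a maximally entangled vector are maximally mixed. Hence the expectation
of a product of two local generators `A ⊗ 1 + 1 ⊗ B` involves only traces `Tr (A A')`, `Tr (B B')`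
and cross terms from commuting factors. It is therefore symmetric in the two generators
(`star_dotProduct_localSum_mul_mulVec_comm`). So the derivative vectors of the model have a real
Gram matrix, which for a pure state means `A = 0`: the vectors `L_j φ` have the real Gram matrix
`F`.

The rest holds for any pure model with `A = 0`. On `N` copies the collective derivative vectors are
orthogonal to the state and have Gram matrix `N F`.

Lower bound: positivity of the effects gives the Cramér–Rao inequality in the linearised form
`two_mul_dotProduct_le`. A single rank-one weight then yields `r_N ≥ 1`.

Upper bound: real combinations of the collective vectors form an orthonormal family `v k`. Measuring
along `φ ± √d v k` is exactly locally unbiased at `θ`, with mean square error `F⁻¹ / N`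
(`exists_locallyUnbiased_of_mem`). Its estimates lie within `O(1/√N)` of `θ`, hence in the open set
`Θ` for large `N`. Thus `r_N = 1` eventually. -/

namespace QEstimation

/-! ### Product and collective vectors on `N` copies -/

section ProductVectors

variable {n : Type*} {N : ℕ}

/-- The product vector `f 0 ⊗ ⋯ ⊗ f (N - 1)`. -/
def productVector (f : Fin N → n → ℂ) : (Fin N → n) → ℂ := fun x => ∏ k, f k (x k)

/-- The sum over `k` of the vectors `φ ⊗ ⋯ ⊗ w ⊗ ⋯ ⊗ φ` with `w` at the site `k`. -/
def collectiveVector (N : ℕ) (φ w : n → ℂ) : (Fin N → n) → ℂ :=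
  ∑ k, productVector (Function.update (fun _ => φ) k w)

theorem star_productVector_dotProduct [Fintype n] (f g : Fin N → n → ℂ) :
    star (productVector f) ⬝ᵥ productVector g = ∏ k, star (f k) ⬝ᵥ g k := by
  simp only [dotProduct, productVector, Pi.star_apply, star_prod, ← Finset.prod_mul_distrib,
    Finset.prod_univ_sum, Fintype.piFinset_univ]

theorem productVector_update (φ w : n → ℂ) (k : Fin N) (x : Fin N → n) :
    productVector (Function.update (fun _ => φ) k w) x =
      (∏ m ∈ Finset.univ.erase k, φ (x m)) * w (x k) := by
  rw [productVector, ← Finset.prod_erase_mul _ _ (Finset.mem_univ k)]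
  congr 1
  · refine Finset.prod_congr rfl fun m hm => ?_
    rw [Function.update_of_ne (Finset.ne_of_mem_erase hm)]
  · rw [Function.update_self]

theorem tensorPow_pureState (φ : n → ℂ) :
    tensorPow N (pureState φ) = pureState (productVector fun _ : Fin N => φ) := by
  ext x y
  simp [tensorPow, pureState, productVector, vecMulVec_apply, Finset.prod_mul_distrib]

theorem collectiveVector_sum_smul {ι : Type*} (s : Finset ι) (φ : n → ℂ) (c : ι → ℂ)
    (w : ι → n → ℂ) :
    collectiveVector N φ (∑ j ∈ s, c j • w j) = ∑ j ∈ s, c j • collectiveVector N φ (w j) := by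
  ext x
  simp only [collectiveVector, Finset.sum_apply, productVector_update, Pi.smul_apply, smul_eq_mul,
    Finset.mul_sum]
  rw [Finset.sum_comm]
  exact Finset.sum_congr rfl fun _ _ => Finset.sum_congr rfl fun _ _ => by ring

variable [Fintype n] {φ : n → ℂ}

theorem star_productVector_dotProduct_collectiveVector {w : n → ℂ} (hw : star φ ⬝ᵥ w = 0) :
    star (productVector fun _ : Fin N => φ) ⬝ᵥ collectiveVector N φ w = 0 := by
  rw [collectiveVector, dotProduct_sum]
  refine Finset.sum_eq_zero fun k _ => ?_
  rw [star_productVector_dotProduct]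
  exact Finset.prod_eq_zero (Finset.mem_univ k) (by rw [Function.update_self, hw])

theorem star_productVector_dotProduct_self (hφ : star φ ⬝ᵥ φ = 1) :
    star (productVector fun _ : Fin N => φ) ⬝ᵥ productVector (fun _ : Fin N => φ) = 1 := by
  simp [star_productVector_dotProduct, hφ]

/-- Terms excited at different sites contain a factor `⟨φ, w⟩ = 0`, so only the `N` diagonal terms
survive. This is the additivity of the Fisher information. -/
theorem star_collectiveVector_dotProduct (hφ : star φ ⬝ᵥ φ = 1) {v w : n → ℂ}
    (hw : star φ ⬝ᵥ w = 0) :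
    star (collectiveVector N φ v) ⬝ᵥ collectiveVector N φ w = N * star v ⬝ᵥ w := by
  have h : ∀ k l : Fin N, star (productVector (Function.update (fun _ => φ) k v)) ⬝ᵥ
      productVector (Function.update (fun _ => φ) l w) = if k = l then star v ⬝ᵥ w else 0 := by
    intro k l
    rw [star_productVector_dotProduct]
    split_ifs with hkl
    · subst hkl
      rw [← Finset.prod_erase_mul _ _ (Finset.mem_univ k), Finset.prod_eq_one]
      · simp
      · intro m hm
        simp [Function.update_of_ne (Finset.ne_of_mem_erase hm), hφ]
    · refine Finset.prod_eq_zero (Finset.mem_univ l) ?_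
      rw [Function.update_self, Function.update_of_ne (Ne.symm hkl), hw]
  simp only [collectiveVector, star_sum, sum_dotProduct, dotProduct_sum, h]
  simp

end ProductVectors

/-! ### Derivatives of pure states -/

section Tangent

variable {n : Type*}

/-- The tangent operator `(|φ⟩⟨w| + |w⟩⟨φ|) / 2`. -/
noncomputable def tangent (φ w : n → ℂ) : Matrix n n ℂ :=
  (1 / 2 : ℂ) • (vecMulVec φ (star w) + vecMulVec w (star φ))

theorem tangent_sum_smul {ι : Type*} (s : Finset ι) (v : ι → ℝ) (φ : n → ℂ) (w : ι → n → ℂ) :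
    tangent φ (∑ j ∈ s, (v j : ℂ) • w j) = ∑ j ∈ s, v j • tangent φ (w j) := by
  ext a b
  simp only [tangent, Matrix.smul_apply, Matrix.add_apply, vecMulVec_apply, Matrix.sum_apply,
    Finset.sum_apply, Pi.star_apply, star_sum, Pi.smul_apply, star_smul, smul_eq_mul,
    Finset.mul_sum, Finset.sum_mul, ← Finset.sum_add_distrib, Complex.real_smul]
  refine Finset.sum_congr rfl fun j _ => ?_
  simp only [RCLike.star_def, Complex.conj_ofReal]
  ring

/-- Leibniz rule over the sites. Only the projector is assumed differentiable, so the phase of `φ t`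
plays no role. -/
theorem hasDerivAt_tensorPow {N : ℕ} {φ : ℝ → n → ℂ} {w : n → ℂ}
    (h : ∀ a b, HasDerivAt (fun t => pureState (φ t) a b) (tangent (φ 0) w a b) 0)
    (x y : Fin N → n) :
    HasDerivAt (fun t => tensorPow N (pureState (φ t)) x y)
      (tangent (productVector fun _ : Fin N => φ 0) (collectiveVector N (φ 0) w) x y) 0 := by
  have h1 := HasDerivAt.fun_finsetProd (u := (Finset.univ : Finset (Fin N)))
    (fun k _ => h (x k) (y k))
  suffices e : tangent (productVector fun _ : Fin N => φ 0) (collectiveVector N (φ 0) w) x y =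
      ∑ k, (∏ m ∈ Finset.univ.erase k, pureState (φ 0) (x m) (y m)) •
        tangent (φ 0) w (x k) (y k) by
    rw [e]
    exact h1
  simp only [tangent, collectiveVector, Matrix.smul_apply, Matrix.add_apply, vecMulVec_apply,
    Finset.sum_apply, Pi.star_apply, star_sum, Finset.mul_sum, Finset.sum_mul,
    ← Finset.sum_add_distrib, smul_eq_mul, pureState, Finset.prod_mul_distrib]
  refine Finset.sum_congr rfl fun k _ => ?_
  have e (z : Fin N → n) : productVector (fun _ => φ 0) z =
      (∏ m ∈ Finset.univ.erase k, φ 0 (z m)) * φ 0 (z k) :=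
    (Finset.prod_erase_mul _ _ (Finset.mem_univ k)).symm
  simp only [productVector_update, e, star_mul', star_prod]
  ring

variable [Fintype n]

theorem trace_mul_vecMulVec_star (E : Matrix n n ℂ) (a b : n → ℂ) :
    (E * vecMulVec a (star b)).trace = star b ⬝ᵥ E *ᵥ a := by
  rw [mul_vecMulVec, trace_vecMulVec, dotProduct_comm]

theorem star_dotProduct_mulVec {E : Matrix n n ℂ} (hE : E.IsHermitian) (a b : n → ℂ) :
    star b ⬝ᵥ E *ᵥ a = star (star a ⬝ᵥ E *ᵥ b) := by
  rw [star_dotProduct, star_mulVec, hE.eq, ← dotProduct_mulVec]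

theorem trace_mul_tangent_re {E : Matrix n n ℂ} (hE : E.IsHermitian) (φ w : n → ℂ) :
    (E * tangent φ w).trace.re = (star w ⬝ᵥ E *ᵥ φ).re := by
  rw [tangent, mul_smul_comm, mul_add, trace_smul, trace_add, trace_mul_vecMulVec_star,
    trace_mul_vecMulVec_star, star_dotProduct_mulVec hE w φ]
  simp
  ring

theorem tangent_pureState_eq {φ : n → ℂ} {L : Matrix n n ℂ} (hL : L.IsHermitian) :
    (1 / 2 : ℂ) • (pureState φ * L + L * pureState φ) = tangent φ (L *ᵥ φ) := by
  rw [tangent, pureState, vecMulVec_mul, mul_vecMulVec, star_mulVec, hL.eq]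

end Tangent

/-- Estimates may be unbounded, so the operator `∫ x dM` need not exist; only its pairing with
states near the given one does. The vectors on which `T n` converges form a subspace, closed because
the dimension is finite. It contains the curve near `0` and hence the derivative, and the limit
functional is continuous on it. -/
theorem tendsto_apply_of_hasDerivAt {E : Type*} [NormedAddCommGroup E] [NormedSpace ℝ E]
    [FiniteDimensional ℝ E] (T : ℕ → E →L[ℝ] ℝ) {c : ℝ → E} {c' : E} {h : ℝ → ℝ} {h' : ℝ}
    (hc : HasDerivAt c c' 0) (hh : HasDerivAt h h' 0)
    (hT : ∀ᶠ t in 𝓝 0, Tendsto (fun n => T n (c t)) atTop (𝓝 (h t))) :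
    Tendsto (fun n => T n c') atTop (𝓝 h') := by
  let V : Submodule ℝ E :=
    { carrier := {x | ∃ l, Tendsto (fun n => T n x) atTop (𝓝 l)}
      add_mem' := by
        rintro x y ⟨l, hl⟩ ⟨m, hm⟩
        exact ⟨l + m, by simpa using hl.add hm⟩
      zero_mem' := ⟨0, by simp⟩
      smul_mem' := by
        rintro r x ⟨l, hl⟩
        exact ⟨r * l, by simpa using hl.const_mul r⟩ }
  choose S hS using fun x : V => x.2
  have : CompleteSpace V := FiniteDimensional.complete ℝ V
  let S' : V →L[ℝ] ℝ := continuousLinearMapOfTendsto (fun n => (T n).comp V.subtypeL)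
    (f := S) (tendsto_pi_nhds.2 fun x => hS x)
  have hS' : ∀ x : V, Tendsto (fun n => T n x) atTop (𝓝 (S' x)) := hS
  -- A linear projection onto `V` turns the curve into one with values in `V` for all `t`, so that
  -- it can be differentiated there.
  obtain ⟨p, hp⟩ := LinearMap.exists_leftInverse_of_injective V.subtype
    (LinearMap.ker_eq_bot.2 V.injective_subtype)
  have hp' : ∀ x : V, p x = x := fun x => LinearMap.congr_fun hp x
  let P : E →L[ℝ] V := p.toContinuousLinearMap
  have hP : ∀ x ∈ V, ((P x : V) : E) = x := fun x hx => congrArg Subtype.val (hp' ⟨x, hx⟩)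
  have hcV : ∀ᶠ t in 𝓝 (0 : ℝ), c t ∈ V := hT.mono fun t ht => ⟨_, ht⟩
  have hcP : HasDerivAt (fun t => P (c t)) (P c') 0 := P.hasFDerivAt.comp_hasDerivAt 0 hc
  have h1 : ((P c' : V) : E) = c' := by
    refine HasDerivAt.unique (f := c) ?_ hc
    refine (V.subtypeL.hasFDerivAt.comp_hasDerivAt 0 hcP).congr_of_eventuallyEq ?_
    filter_upwards [hcV] with t ht using (hP _ ht).symm
  have h2 : S' (P c') = h' := by
    refine HasDerivAt.unique (f := h) ?_ hh
    refine (S'.hasFDerivAt.comp_hasDerivAt 0 hcP).congr_of_eventuallyEq ?_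
    filter_upwards [hcV, hT] with t ht ht'
    refine tendsto_nhds_unique ht' ?_
    have := hS' (P (c t))
    rwa [hP _ ht] at this
  have := hS' (P c')
  rwa [h1, h2] at this

/-- Expand the positivity of `E` at the vector `w - r φ`. Unlike Cauchy–Schwarz, the result is
linear in `E` and can be summed over outcomes. -/
theorem two_mul_trace_mul_tangent_le {n : Type*} [Fintype n] {E : Matrix n n ℂ}
    (hE : E.PosSemidef) (φ w : n → ℂ) (r : ℝ) : 2 * (r * (E * tangent φ w).trace.re) ≤
      r ^ 2 * (E * pureState φ).trace.re + (star w ⬝ᵥ E *ᵥ w).re := by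
  have h := (Complex.le_def.1 (hE.dotProduct_mulVec_nonneg (w - (r : ℂ) • φ))).1
  rw [trace_mul_tangent_re hE.isHermitian, pureState, trace_mul_vecMulVec_star]
  simp only [star_sub, star_smul, mulVec_sub, mulVec_smul, sub_dotProduct, dotProduct_sub,
    smul_dotProduct, dotProduct_smul] at h
  rw [star_dotProduct_mulVec hE.isHermitian w φ] at h
  simp only [smul_eq_mul, RCLike.star_def, Complex.conj_ofReal, Complex.sub_re, Complex.mul_re,
    Complex.ofReal_re, Complex.ofReal_im, Complex.zero_re, Complex.conj_re, 
    zero_mul, sub_zero] at h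
  linarith

/-! ### Integrating simple functions against a measurement -/

section POVM

variable {Ω : Type*} [MeasurableSpace Ω] {n : Type*} [Fintype n] [DecidableEq n]

theorem POVM.born_apply (M : POVM Ω n) {σ : Matrix n n ℂ} (hσ : σ.PosSemidef) {B : Set Ω}
    (hB : MeasurableSet B) : M.born σ hσ B = ENNReal.ofReal (M.effect B * σ).trace.re :=
  Measure.ofMeasurable_apply B hB

theorem POVM.born_real (M : POVM Ω n) {σ : Matrix n n ℂ} (hσ : σ.PosSemidef) {B : Set Ω}
    (hB : MeasurableSet B) : (M.born σ hσ).real B = (M.effect B * σ).trace.re := by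
  rw [Measure.real, M.born_apply hσ hB,
    ENNReal.toReal_ofReal (re_trace_mul_nonneg (M.posSemidef B) hσ)]

theorem POVM.isProbabilityMeasure_born (M : POVM Ω n) {σ : Matrix n n ℂ} (hσ : σ.PosSemidef)
    (h1 : σ.trace = 1) : IsProbabilityMeasure (M.born σ hσ) :=
  ⟨by rw [M.born_apply hσ MeasurableSet.univ, M.effect_univ, one_mul, h1]; simp⟩

instance POVM.isFiniteMeasure_born (M : POVM Ω n) {σ : Matrix n n ℂ} (hσ : σ.PosSemidef) :
    IsFiniteMeasure (M.born σ hσ) :=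
  ⟨by rw [M.born_apply hσ MeasurableSet.univ]; exact ENNReal.ofReal_lt_top⟩

/-- The operator `∫ g dM` for a simple function `g`. -/
noncomputable def POVM.simpleIntegral (M : POVM Ω n) (g : SimpleFunc Ω ℝ) : Matrix n n ℂ :=
  ∑ r ∈ g.range, r • M.effect (g ⁻¹' {r})

theorem POVM.integral_simpleFunc (M : POVM Ω n) {σ : Matrix n n ℂ} (hσ : σ.PosSemidef)
    (g : SimpleFunc Ω ℝ) :
    ∫ x, g x ∂(M.born σ hσ) = (M.simpleIntegral g * σ).trace.re := by
  rw [← SimpleFunc.integral_eq_integral g (SimpleFunc.integrable_of_isFiniteMeasure g),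
    SimpleFunc.integral_eq, POVM.simpleIntegral, Finset.sum_mul, trace_sum, Complex.re_sum]
  refine Finset.sum_congr rfl fun r _ => ?_
  rw [M.born_real hσ (g.measurableSet_fiber r), smul_mul_assoc, trace_smul, Complex.smul_re,
    smul_eq_mul, smul_eq_mul, mul_comm]

theorem POVM.integral_simpleFunc_sq (M : POVM Ω n) {σ : Matrix n n ℂ} (hσ : σ.PosSemidef)
    (g : SimpleFunc Ω ℝ) :
    ∫ x, g x ^ 2 ∂(M.born σ hσ) =
      ∑ r ∈ g.range, r ^ 2 * (M.effect (g ⁻¹' {r}) * σ).trace.re := by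
  have h := SimpleFunc.map_integral (μ := M.born σ hσ) g (fun r => r ^ 2)
    (SimpleFunc.integrable_of_isFiniteMeasure g) (by simp)
  rw [SimpleFunc.integral_eq_integral _ (SimpleFunc.integrable_of_isFiniteMeasure _)] at h
  refine h.trans (Finset.sum_congr rfl fun r _ => ?_)
  rw [M.born_real hσ (g.measurableSet_fiber r), smul_eq_mul, mul_comm]

theorem POVM.sum_effect_fiber (M : POVM Ω n) (g : SimpleFunc Ω ℝ) :
    ∑ r ∈ g.range, M.effect (g ⁻¹' {r}) = 1 := by
  rw [← M.effect_univ, ← VectorMeasure.of_biUnion_finset]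
  · congr 1
    ext x
    simp
  · intro r _ s _ hrs
    exact Disjoint.preimage g (by simpa using hrs)
  · intro r _
    exact g.measurableSet_fiber r

/-- Sum the inequality for one effect over the fibres of `g`, with `r` the value of `g`; the effects
add up to `1`, which leaves `⟨w, w⟩`. -/
theorem POVM.two_mul_trace_simpleIntegral_mul_tangent_le (M : POVM Ω n) (φ w : n → ℂ)
    (g : SimpleFunc Ω ℝ) :
    2 * (M.simpleIntegral g * tangent φ w).trace.re ≤
      ∫ x, g x ^ 2 ∂(M.born (pureState φ) (pureState_posSemidef φ)) + (star w ⬝ᵥ w).re := by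
  have h : (star w ⬝ᵥ w).re = ∑ r ∈ g.range, (star w ⬝ᵥ M.effect (g ⁻¹' {r}) *ᵥ w).re := by
    rw [← Complex.re_sum, ← dotProduct_sum, ← sum_mulVec, M.sum_effect_fiber, one_mulVec]
  rw [M.integral_simpleFunc_sq, h, ← Finset.sum_add_distrib, POVM.simpleIntegral, Finset.sum_mul,
    trace_sum, Complex.re_sum, Finset.mul_sum]
  refine Finset.sum_le_sum fun r _ => ?_
  rw [smul_mul_assoc, trace_smul, Complex.smul_re, smul_eq_mul]
  exact two_mul_trace_mul_tangent_le (M.posSemidef _) φ w r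

end POVM

theorem POVM.born_congr {Ω : Type*} [MeasurableSpace Ω] {n : Type*} [Fintype n] [DecidableEq n]
    (M : POVM Ω n) {σ τ : Matrix n n ℂ} (h : σ = τ) (hσ : σ.PosSemidef) (hτ : τ.PosSemidef) :
    M.born σ hσ = M.born τ hτ := by
  subst h
  rfl

theorem star_sum_smul_dotProduct_sum_smul {n : Type*} [Fintype n] {d : ℕ}
    {w : Fin d → n → ℂ} {F : Matrix (Fin d) (Fin d) ℝ}
    (hF : ∀ i j, star (w i) ⬝ᵥ w j = (F i j : ℂ)) (u v : Fin d → ℝ) :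
    star (∑ j, (u j : ℂ) • w j) ⬝ᵥ ∑ j, (v j : ℂ) • w j = ((u ⬝ᵥ F *ᵥ v : ℝ) : ℂ) := by
  simp only [star_sum, star_smul, sum_dotProduct, dotProduct_sum, smul_dotProduct,
    dotProduct_smul, hF, smul_eq_mul, RCLike.star_def, Complex.conj_ofReal]
  simp only [dotProduct, mulVec, Finset.mul_sum]
  push_cast
  rw [Finset.sum_comm]
  exact Finset.sum_congr rfl fun _ _ => Finset.sum_congr rfl fun _ _ => by ring

theorem sq_sum_mul_sub {d : ℕ} (u x θ : Fin d → ℝ) : (∑ i, u i * (x i - θ i)) ^ 2 =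
    ∑ i, ∑ j, u i * u j * ((x i - θ i) * (x j - θ j)) := by
  rw [sq, Finset.sum_mul_sum]
  exact Finset.sum_congr rfl fun _ _ => Finset.sum_congr rfl fun _ _ => by ring

/-! ### The quantum Cramér–Rao inequality -/

section CramerRao

variable {n : Type*} [Fintype n] [DecidableEq n] {d N : ℕ} {Θ : Set (Fin d → ℝ)}
  {φ : (Fin d → ℝ) → n → ℂ} {hρ : ∀ η, (pureState (φ η)).PosSemidef} {θ : Fin d → ℝ}
  {w : Fin d → n → ℂ} {M : POVM Θ (Fin N → n)}

theorem isProbabilityMeasure_outcomeLaw (hφ : ∀ η, star (φ η) ⬝ᵥ φ η = 1) (η : Fin d → ℝ) :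
    IsProbabilityMeasure (outcomeLaw Θ (fun η => pureState (φ η)) hρ N M η) := by
  refine M.isProbabilityMeasure_born _ ?_
  rw [tensorPow_pureState, pureState, trace_vecMulVec, dotProduct_comm,
    star_productVector_dotProduct_self (hφ η)]

/-- The integral of `∑ i, u i * (x i - θ i)` against the law of the outcome, as a limit of
integrals of simple functions, depends on the state through a linear functional, which can be
evaluated on the derivative of the state. -/
theorem LocallyUnbiased.tendsto_trace_simpleIntegral (hφ : ∀ η, star (φ η) ⬝ᵥ φ η = 1)
    (h : LocallyUnbiased Θ (fun η => pureState (φ η)) hρ N M θ)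
    (hw : ∀ j a b, HasDerivAt (fun t : ℝ => pureState (φ (θ + t • Pi.single j 1)) a b)
      (tangent (φ θ) (w j) a b) 0)
    (u : Fin d → ℝ) (g : ℕ → SimpleFunc Θ ℝ)
    (hg : ∀ x : Θ, Tendsto (fun k => g k x) atTop (𝓝 (∑ i, u i * ((x : Fin d → ℝ) i - θ i))))
    (hg' : ∀ k x, ‖g k x‖ ≤ 2 * ‖∑ i, u i * ((x : Fin d → ℝ) i - θ i)‖) (j : Fin d) :
    Tendsto (fun k => (M.simpleIntegral (g k) *
        tangent (productVector fun _ : Fin N => φ θ) (collectiveVector N (φ θ) (w j))).trace.re)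
      atTop (𝓝 (u j)) := by
  let m := Fin N → n
  let T : ℕ → (m → m → ℂ) →L[ℝ] ℝ := fun k => LinearMap.toContinuousLinearMap
    { toFun := fun X => (M.simpleIntegral (g k) * Matrix.of X).trace.re
      map_add' := fun X Y => by rw [← Matrix.of_add_of, mul_add, trace_add, Complex.add_re]
      map_smul' := fun r X => by
        rw [← Matrix.smul_of, mul_smul_comm, trace_smul, Complex.smul_re, RingHom.id_apply] }
  let c : ℝ → m → m → ℂ := fun t =>
    tensorPow N (pureState (φ (θ + t • (Pi.single j 1 : Fin d → ℝ))))
  have hθ : θ + (0 : ℝ) • (Pi.single j 1 : Fin d → ℝ) = θ := by simp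
  have hc : HasDerivAt c (tangent (productVector fun _ : Fin N => φ θ)
      (collectiveVector N (φ θ) (w j))) 0 := by
    refine hasDerivAt_pi.2 fun x => hasDerivAt_pi.2 fun y => ?_
    have := hasDerivAt_tensorPow (N := N) (φ := fun t : ℝ => φ (θ + t • Pi.single j 1))
      (w := w j) (by simpa only [hθ] using hw j) x y
    simpa only [hθ] using this
  -- The mean of `∑ i, u i * (x i - θ i)` in the shifted state: bias plus displacement. The bias has
  -- zero derivative, so the slope is `u j`.
  let b : ℝ → ℝ := fun t =>
    ∑ i, u i * (bias Θ (fun η => pureState (φ η)) hρ N M i (θ + t • Pi.single j 1) +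
      t * (Pi.single j 1 : Fin d → ℝ) i)
  have hb : HasDerivAt b (u j) 0 := by
    have h1 : HasDerivAt b (∑ i, u i * (0 + 1 * (Pi.single j 1 : Fin d → ℝ) i)) 0 :=
      HasDerivAt.fun_sum fun i _ =>
        ((h.deriv_bias i j).add ((hasDerivAt_id (0 : ℝ)).mul_const _)).const_mul (u i)
    simpa [Pi.single_apply] using h1
  refine tendsto_apply_of_hasDerivAt T hc hb ?_
  have hcont : Tendsto (fun t : ℝ => θ + t • (Pi.single j 1 : Fin d → ℝ)) (𝓝 0) (𝓝 θ) := by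
    have : Continuous fun t : ℝ => θ + t • (Pi.single j 1 : Fin d → ℝ) := by fun_prop
    simpa only [hθ] using this.tendsto 0
  filter_upwards [hcont.eventually h.integrable_nhds] with t ht
  set η := θ + t • (Pi.single j 1 : Fin d → ℝ) with hη
  have := isProbabilityMeasure_outcomeLaw (Θ := Θ) (hρ := hρ) (M := M) hφ η
  have hint : ∀ i, Integrable (fun x : Θ => u i * ((x : Fin d → ℝ) i - θ i))
      (outcomeLaw Θ (fun η => pureState (φ η)) hρ N M η) :=
    fun i => ((ht i).sub (integrable_const _)).const_mul _
  have hb' : b t = ∫ x : Θ, ∑ i, u i * ((x : Fin d → ℝ) i - θ i)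
      ∂(outcomeLaw Θ (fun η => pureState (φ η)) hρ N M η) := by
    rw [integral_finsetSum _ fun i _ => hint i]
    refine Finset.sum_congr rfl fun i _ => ?_
    have hηi : η i = θ i + t * (Pi.single j 1 : Fin d → ℝ) i := by simp [hη]
    rw [integral_const_mul, integral_sub (ht i) (integrable_const _), bias, integral_const,
      probReal_univ, ← hη, hηi, one_smul]
    ring
  rw [hb']
  have key : ∀ k, T k (c t) =
      ∫ x, g k x ∂(outcomeLaw Θ (fun η => pureState (φ η)) hρ N M η) :=
    fun k => (M.integral_simpleFunc _ (g k)).symm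
  simp only [key]
  exact tendsto_integral_of_dominated_convergence _
    (fun k => (g k).measurable.aestronglyMeasurable)
    ((integrable_finsetSum _ fun i _ => hint i).norm.const_mul 2)
    (fun k => .of_forall (hg' k)) (.of_forall hg)

theorem measurable_sub_const_apply (i : Fin d) :
    Measurable fun x : Θ => (x : Fin d → ℝ) i - θ i :=
  ((measurable_pi_apply i).comp measurable_subtype_coe).sub_const _

theorem LocallyUnbiased.integrable_mul (h : LocallyUnbiased Θ (fun η => pureState (φ η)) hρ N M θ)
    (i j : Fin d) : Integrable
      (fun x : Θ => ((x : Fin d → ℝ) i - θ i) * ((x : Fin d → ℝ) j - θ j))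
      (outcomeLaw Θ (fun η => pureState (φ η)) hρ N M θ) := by
  have hL2 : ∀ i, MemLp (fun x : Θ => (x : Fin d → ℝ) i - θ i) 2
      (outcomeLaw Θ (fun η => pureState (φ η)) hρ N M θ) := fun i =>
    (memLp_two_iff_integrable_sq (measurable_sub_const_apply i).aestronglyMeasurable).2
      (h.integrable_sq i)
  exact (hL2 i).integrable_mul (hL2 j)

theorem LocallyUnbiased.integrable_sq_sum
    (h : LocallyUnbiased Θ (fun η => pureState (φ η)) hρ N M θ) (u : Fin d → ℝ) :
    Integrable (fun x : Θ => (∑ i, u i * ((x : Fin d → ℝ) i - θ i)) ^ 2)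
      (outcomeLaw Θ (fun η => pureState (φ η)) hρ N M θ) := by
  simp only [sq_sum_mul_sub]
  exact integrable_finsetSum _ fun i _ => integrable_finsetSum _ fun j _ =>
    (h.integrable_mul i j).const_mul _

theorem LocallyUnbiased.integral_sq_sum
    (h : LocallyUnbiased Θ (fun η => pureState (φ η)) hρ N M θ) (u : Fin d → ℝ) :
    ∫ x : Θ, (∑ i, u i * ((x : Fin d → ℝ) i - θ i)) ^ 2
      ∂(outcomeLaw Θ (fun η => pureState (φ η)) hρ N M θ) =
      u ⬝ᵥ mse Θ (fun η => pureState (φ η)) hρ N M θ *ᵥ u := by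
  simp only [sq_sum_mul_sub]
  rw [integral_finsetSum _ fun i _ => integrable_finsetSum _ fun j _ =>
    (h.integrable_mul i j).const_mul _]
  simp only [dotProduct, mulVec, mse, Matrix.of_apply, Finset.mul_sum]
  refine Finset.sum_congr rfl fun i _ => ?_
  rw [integral_finsetSum _ fun j _ => (h.integrable_mul i j).const_mul _]
  refine Finset.sum_congr rfl fun j _ => ?_
  rw [integral_const_mul]
  ring

/-- Apply the operator inequality to simple approximations of `∑ i, u i * (x i - θ i)` and to the
collective vector of `∑ j, v j • w j`, then pass to the limit. Optimising over `v` gives the usual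
bound `Σ ≥ F⁻¹ / N`. -/
theorem LocallyUnbiased.two_mul_dotProduct_le (hφ : ∀ η, star (φ η) ⬝ᵥ φ η = 1)
    (h : LocallyUnbiased Θ (fun η => pureState (φ η)) hρ N M θ)
    (hw : ∀ j a b, HasDerivAt (fun t : ℝ => pureState (φ (θ + t • Pi.single j 1)) a b)
      (tangent (φ θ) (w j) a b) 0) (horth : ∀ j, star (φ θ) ⬝ᵥ w j = 0)
    {F : Matrix (Fin d) (Fin d) ℝ} (hF : ∀ i j, star (w i) ⬝ᵥ w j = (F i j : ℂ))
    (u v : Fin d → ℝ) :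
    2 * (u ⬝ᵥ v) ≤ u ⬝ᵥ mse Θ (fun η => pureState (φ η)) hρ N M θ *ᵥ u +
      N * (v ⬝ᵥ F *ᵥ v) := by
  have hfm : Measurable fun x : Θ => ∑ i, u i * ((x : Fin d → ℝ) i - θ i) :=
    Finset.measurable_sum _ fun i _ => (measurable_sub_const_apply i).const_mul _
  let g : ℕ → SimpleFunc Θ ℝ := SimpleFunc.approxOn _ hfm Set.univ 0 (Set.mem_univ 0)
  have hg : ∀ x : Θ, Tendsto (fun k => g k x) atTop
      (𝓝 (∑ i, u i * ((x : Fin d → ℝ) i - θ i))) :=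
    fun x => SimpleFunc.tendsto_approxOn hfm (Set.mem_univ 0) (by simp)
  have hg' : ∀ k x, ‖g k x‖ ≤ 2 * ‖∑ i, u i * ((x : Fin d → ℝ) i - θ i)‖ := fun k x => by
    rw [two_mul]
    exact SimpleFunc.norm_approxOn_zero_le hfm (Set.mem_univ 0) x k
  set μ := outcomeLaw Θ (fun η => pureState (φ η)) hρ N M θ with hμ
  set W := collectiveVector N (φ θ) (∑ j, (v j : ℂ) • w j) with hW
  have := isProbabilityMeasure_outcomeLaw (Θ := Θ) (hρ := hρ) (M := M) hφ θ
  have hlim1 : Tendsto (fun k => 2 * (M.simpleIntegral (g k) *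
      tangent (productVector fun _ : Fin N => φ θ) W).trace.re) atTop (𝓝 (2 * (u ⬝ᵥ v))) := by
    have h1 := tendsto_finsetSum Finset.univ fun j _ =>
      (h.tendsto_trace_simpleIntegral hφ hw u g hg hg' j).const_mul (v j)
    rw [dotProduct_comm]
    refine Tendsto.const_mul 2 (h1.congr fun k => ?_)
    rw [hW, collectiveVector_sum_smul, tangent_sum_smul, Finset.mul_sum, trace_sum,
      Complex.re_sum]
    exact Finset.sum_congr rfl fun j _ => by
      rw [mul_smul_comm, trace_smul, Complex.smul_re, smul_eq_mul]
  have hlim2 : Tendsto (fun k => ∫ x, g k x ^ 2 ∂μ + N * (v ⬝ᵥ F *ᵥ v)) atTop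
      (𝓝 (u ⬝ᵥ mse Θ (fun η => pureState (φ η)) hρ N M θ *ᵥ u + N * (v ⬝ᵥ F *ᵥ v))) := by
    rw [← h.integral_sq_sum]
    refine Tendsto.add_const _ (tendsto_integral_of_dominated_convergence _
      (fun k => ((g k).measurable.pow_const 2).aestronglyMeasurable) ((h.integrable_sq_sum u).const_mul 4)
      (fun k => .of_forall fun x => ?_) (.of_forall fun x => (hg x).pow 2))
    rw [norm_pow, ← sq_abs (∑ i, _)]
    calc ‖g k x‖ ^ 2 ≤ (2 * ‖∑ i, u i * ((x : Fin d → ℝ) i - θ i)‖) ^ 2 :=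
          pow_le_pow_left₀ (norm_nonneg _) (hg' k x) 2
      _ = _ := by rw [mul_pow, Real.norm_eq_abs]; norm_num
  refine le_of_tendsto_of_tendsto' hlim1 hlim2 fun k => ?_
  refine (M.two_mul_trace_simpleIntegral_mul_tangent_le _ W (g k)).trans (le_of_eq ?_)
  congr 1
  · rw [hμ, outcomeLaw, M.born_congr (tensorPow_pureState _)]
  · have horth' : star (φ θ) ⬝ᵥ ∑ j, (v j : ℂ) • w j = 0 := by
      simp [dotProduct_sum, horth]
    rw [hW, star_collectiveVector_dotProduct (hφ θ) horth']
    rw [star_sum_smul_dotProduct_sum_smul hF]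
    norm_cast

end CramerRao

/-! ### Measurements with finitely many outcomes -/

section FinitePOVM

variable {Ω : Type*} [MeasurableSpace Ω] {n : Type*} [Fintype n] [DecidableEq n] {ι : Type*}
  [Fintype ι]

/-- The measurement with finitely many effects `E i`, whose outcomes are the points `x i`. -/
noncomputable def POVM.ofFintype (E : ι → Matrix n n ℂ) (hE : ∀ i, (E i).PosSemidef)
    (h1 : ∑ i, E i = 1) (x : ι → Ω) : POVM Ω n where
  effect := ∑ i, VectorMeasure.dirac (x i) (E i)
  posSemidef B := by
    rw [FunLike.coe_sum, Finset.sum_apply]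
    refine Matrix.posSemidef_sum _ fun i _ => ?_
    by_cases hB : MeasurableSet B
    · by_cases hx : x i ∈ B
      · rw [VectorMeasure.dirac_apply_of_mem hB hx]
        exact hE i
      · rw [VectorMeasure.dirac_apply_of_notMem hx]
        exact .zero
    · rw [VectorMeasure.not_measurable _ hB]
      exact .zero
  effect_univ := by
    rw [FunLike.coe_sum, Finset.sum_apply, ← h1]
    exact Finset.sum_congr rfl fun i _ =>
      VectorMeasure.dirac_apply_of_mem MeasurableSet.univ (Set.mem_univ _)

variable {E : ι → Matrix n n ℂ} {hE : ∀ i, (E i).PosSemidef} {h1 : ∑ i, E i = 1} {x : ι → Ω}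
  {σ : Matrix n n ℂ} (hσ : σ.PosSemidef)

theorem POVM.born_ofFintype : (POVM.ofFintype E hE h1 x).born σ hσ =
    ∑ i, ENNReal.ofReal (E i * σ).trace.re • Measure.dirac (x i) := by
  ext B hB
  rw [POVM.born_apply _ _ hB, Measure.coe_finsetSum, Finset.sum_apply, POVM.ofFintype,
    FunLike.coe_sum, Finset.sum_apply, Finset.sum_mul, trace_sum, Complex.re_sum,
    ENNReal.ofReal_sum_of_nonneg]
  · refine Finset.sum_congr rfl fun i _ => ?_
    rw [Measure.smul_apply, Measure.dirac_apply' _ hB]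
    by_cases hx : x i ∈ B
    · rw [VectorMeasure.dirac_apply_of_mem hB hx]
      simp [hx]
    · rw [VectorMeasure.dirac_apply_of_notMem hx]
      simp [hx]
  · intro i _
    by_cases hx : x i ∈ B
    · rw [VectorMeasure.dirac_apply_of_mem hB hx]
      exact re_trace_mul_nonneg (hE i) hσ
    · rw [VectorMeasure.dirac_apply_of_notMem hx]
      simp

variable [MeasurableSingletonClass Ω]

theorem POVM.integrable_born_ofFintype (f : Ω → ℝ) :
    Integrable f ((POVM.ofFintype E hE h1 x).born σ hσ) := by
  rw [POVM.born_ofFintype, integrable_finsetSum_measure]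
  exact fun i _ => (integrable_dirac (by simp)).smul_measure ENNReal.ofReal_ne_top

theorem POVM.integral_born_ofFintype (f : Ω → ℝ) :
    ∫ y, f y ∂((POVM.ofFintype E hE h1 x).born σ hσ) = ∑ i, (E i * σ).trace.re * f (x i) := by
  rw [POVM.born_ofFintype, integral_finsetSum_measure
    fun i _ => (integrable_dirac (by simp)).smul_measure ENNReal.ofReal_ne_top]
  refine Finset.sum_congr rfl fun i _ => ?_
  rw [integral_smul_measure, integral_dirac, smul_eq_mul,
    ENNReal.toReal_ofReal (re_trace_mul_nonneg (hE i) hσ)]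

end FinitePOVM

/-! ### The measurement along `φ ± √d v k` -/

section Frame

variable {m : Type*} [Fintype m] [DecidableEq m] {d : ℕ}

theorem pureState_add_smul {m : Type*} (φ v : m → ℂ) (r : ℝ) :
    pureState (φ + (r : ℂ) • v) =
      pureState φ + (2 * r) • tangent φ v + (r ^ 2) • pureState v := by
  ext a b
  simp only [pureState, tangent, vecMulVec_apply, Pi.add_apply, Pi.smul_apply, Pi.star_apply,
    Matrix.add_apply, Matrix.smul_apply, star_add, star_smul, smul_eq_mul, RCLike.star_def,
    Complex.conj_ofReal, Complex.real_smul]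
  push_cast
  ring

/-- The subtracted sum is the orthogonal projection onto the span of an orthonormal family, so its
complement is again a projection. -/
theorem one_sub_pureState_sub_sum_posSemidef {φ : m → ℂ} {v : Fin d → m → ℂ}
    (hφ : star φ ⬝ᵥ φ = 1) (hφv : ∀ k, star φ ⬝ᵥ v k = 0)
    (hv : ∀ k l, star (v k) ⬝ᵥ v l = if k = l then 1 else 0) :
    (1 - (pureState φ + ∑ k, pureState (v k))).PosSemidef := by
  set P := pureState φ + ∑ k, pureState (v k) with hP
  have hvφ : ∀ k, star (v k) ⬝ᵥ φ = 0 := fun k => by rw [star_dotProduct, hφv, star_zero]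
  have hPP : P * P = P := by
    rw [hP, mul_add, add_mul, add_mul, Finset.sum_mul, Finset.mul_sum]
    simp only [Finset.mul_sum, Finset.sum_mul]
    simp [pureState, vecMulVec_mul_vecMulVec, hφ, hφv, hvφ, hv, apply_ite]
  have hPh : Pᴴ = P := by
    have h := (pureState_posSemidef φ).isHermitian.add
      (Matrix.posSemidef_sum Finset.univ
        fun k _ => pureState_posSemidef (v k)).isHermitian
    exact h.eq
  have : 1 - P = (1 - P)ᴴ * (1 - P) := by
    rw [conjTranspose_sub, hPh, conjTranspose_one, sub_mul, mul_sub, mul_sub, hPP]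
    simp
  rw [this]
  exact posSemidef_conjTranspose_mul_self _

/-- The effects of the measurement along the vectors `φ ± √d v k`, completed by the projector onto
the orthogonal complement. -/
noncomputable def frameEffect (φ : m → ℂ) (v : Fin d → m → ℂ) :
    Option (Fin d × Bool) → Matrix m m ℂ
  | none => 1 - (pureState φ + ∑ k, pureState (v k))
  | some (k, s) => (1 / (2 * d) : ℝ) •
      pureState (φ + (((if s then 1 else -1) * √d : ℝ) : ℂ) • v k)

/-- The estimate belonging to an effect of `frameEffect`. -/
noncomputable def frameEstimate (θ : Fin d → ℝ) (c : Matrix (Fin d) (Fin d) ℝ) :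
    Option (Fin d × Bool) → Fin d → ℝ
  | none => θ
  | some (k, s) => fun i => θ i + (if s then 1 else -1) * √d * c i k

theorem frameEffect_posSemidef {φ : m → ℂ} {v : Fin d → m → ℂ}
    (hφ : star φ ⬝ᵥ φ = 1) (hφv : ∀ k, star φ ⬝ᵥ v k = 0)
    (hv : ∀ k l, star (v k) ⬝ᵥ v l = if k = l then 1 else 0) (i : Option (Fin d × Bool)) :
    (frameEffect φ v i).PosSemidef := by
  rcases i with _ | ⟨k, s⟩
  · exact one_sub_pureState_sub_sum_posSemidef hφ hφv hv
  · exact (pureState_posSemidef _).smul (by positivity)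

/-- The two signs cancel the cross terms. With the weight `1 / (2 d)`, the factor `√d` gives each `v
k` full weight, while `φ` is shared among the `d` pairs. -/
theorem sum_frameEffect {m : Type*} [DecidableEq m] (hd : 0 < d) (φ : m → ℂ) (v : Fin d → m → ℂ) :
    ∑ i, frameEffect φ v i = 1 := by
  have hd' : (d : ℝ) ≠ 0 := by positivity
  have hk : ∀ k, (1 / (2 * d) : ℝ) • pureState (φ + (((1 : ℝ) * √d : ℝ) : ℂ) • v k) +
      (1 / (2 * d) : ℝ) • pureState (φ + (((-1 : ℝ) * √d : ℝ) : ℂ) • v k) =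
        (1 / d : ℝ) • pureState φ + pureState (v k) := by
    intro k
    rw [pureState_add_smul, pureState_add_smul]
    simp only [one_mul, mul_pow, Real.sq_sqrt (Nat.cast_nonneg d)]
    match_scalars <;> field_simp <;> ring
  rw [Fintype.sum_option, Fintype.sum_prod_type]
  simp only [Fintype.sum_bool, frameEffect, if_true, Bool.false_eq_true, if_false, hk,
    Finset.sum_add_distrib, Finset.sum_const, Finset.card_univ, Fintype.card_fin]
  rw [← Nat.cast_smul_eq_nsmul ℝ, smul_smul, mul_one_div_cancel hd', one_smul]
  abel

/-- The estimates are odd in the sign, so only the cross terms of the effects survive; the outcome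
`none` has deviation `0`. -/
theorem sum_frameEffect_mul_estimate (φ : m → ℂ) (v : Fin d → m → ℂ) (hd : 0 < d)
    (θ : Fin d → ℝ) (c : Matrix (Fin d) (Fin d) ℝ) (σ : Matrix m m ℂ) (i : Fin d) :
    ∑ a, (frameEffect φ v a * σ).trace.re * (frameEstimate θ c a i - θ i) =
      ∑ k, 2 * c i k * (tangent φ (v k) * σ).trace.re := by
  have hd' : (d : ℝ) ≠ 0 := by positivity
  have hs : √(d : ℝ) * √d = d := Real.mul_self_sqrt (Nat.cast_nonneg d)
  rw [Fintype.sum_option, Fintype.sum_prod_type]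
  simp only [Fintype.sum_bool, frameEffect, frameEstimate, if_true, Bool.false_eq_true, if_false,
    sub_self, mul_zero, zero_add, pureState_add_smul, smul_mul_assoc, add_mul, trace_add,
    trace_smul, Complex.smul_re, Complex.add_re, smul_eq_mul]
  refine Finset.sum_congr rfl fun k _ => ?_
  field_simp
  linear_combination (4 * c i k * (tangent φ (v k) * σ).trace.re) * hs

/-- Each signed outcome has probability `1 / (2 d)` in the state `φ`, since `⟨φ ± √d v k, φ⟩ = 1`;
this cancels the factor `d` in the squared deviations. -/
theorem sum_frameEffect_mul_estimate_mul {φ : m → ℂ} {v : Fin d → m → ℂ} (hd : 0 < d)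
    (hφ : star φ ⬝ᵥ φ = 1) (hφv : ∀ k, star φ ⬝ᵥ v k = 0)
    (θ : Fin d → ℝ) (c : Matrix (Fin d) (Fin d) ℝ) (i j : Fin d) :
    ∑ a, (frameEffect φ v a * pureState φ).trace.re *
        ((frameEstimate θ c a i - θ i) * (frameEstimate θ c a j - θ j)) = (c * cᵀ) i j := by
  have hd' : (d : ℝ) ≠ 0 := by positivity
  have hs : √(d : ℝ) * √d = d := Real.mul_self_sqrt (Nat.cast_nonneg d)
  have hvφ : ∀ k, star (v k) ⬝ᵥ φ = 0 := fun k => by rw [star_dotProduct, hφv, star_zero]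
  have hp : ∀ (k : Fin d) (r : ℝ),
      (pureState (φ + (r : ℂ) • v k) * pureState φ).trace = 1 := by
    intro k r
    rw [pureState, pureState, vecMulVec_mul_vecMulVec, trace_vecMulVec]
    simp [hφ, hvφ, add_dotProduct, dotProduct_comm _ (star φ), hφv]
  rw [Fintype.sum_option, Fintype.sum_prod_type, Matrix.mul_apply]
  simp only [Fintype.sum_bool, frameEffect, frameEstimate, if_true, Bool.false_eq_true, if_false,
    sub_self, mul_zero, zero_add, smul_mul_assoc, hp,
    trace_smul, Complex.smul_re, Complex.one_re, smul_eq_mul, transpose_apply]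
  refine Finset.sum_congr rfl fun k _ => ?_
  field_simp
  linear_combination (2 * c i k * c j k) * hs

theorem tangent_mulVec {m : Type*} [Fintype m] {φ v : m → ℂ} (hφ : star φ ⬝ᵥ φ = 1) (hφv : star φ ⬝ᵥ v = 0) :
    tangent φ v *ᵥ φ = (1 / 2 : ℂ) • v := by
  rw [tangent, smul_mulVec, add_mulVec, vecMulVec_mulVec, vecMulVec_mulVec, hφ, star_dotProduct,
    hφv]
  simp

theorem tangent_isHermitian {m : Type*} (φ v : m → ℂ) : (tangent φ v).IsHermitian := by
  ext a b
  simp [tangent, vecMulVec_apply]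
  ring

end Frame

/-! ### A locally unbiased measurement attaining the bound -/

section OptimalMeasurement

-- Write `F = Bᵀ B` and take `C = B⁻¹`. The columns of `C` are orthonormal for `F` and supply the
-- coefficients of the frame.
open scoped MatrixOrder in
theorem exists_mul_transpose_eq_inv {d : ℕ} {F : Matrix (Fin d) (Fin d) ℝ} (hF : F.PosDef) :
    ∃ C : Matrix (Fin d) (Fin d) ℝ, C * Cᵀ = F⁻¹ ∧ Cᵀ * F * C = 1 := by
  obtain ⟨B, hB⟩ := CStarAlgebra.nonneg_iff_eq_star_mul_self.mp hF.posSemidef.nonneg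
  rw [star_eq_conjTranspose, conjTranspose_eq_transpose_of_trivial] at hB
  have hu : IsUnit B := by
    have h : IsUnit (Bᵀ * B).det := hB ▸ (Matrix.isUnit_iff_isUnit_det F).1 hF.isUnit
    rw [det_mul] at h
    exact (Matrix.isUnit_iff_isUnit_det B).2 (isUnit_of_mul_isUnit_right h)
  have hd := (Matrix.isUnit_iff_isUnit_det B).1 hu
  refine ⟨B⁻¹, ?_, ?_⟩
  · rw [hB, Matrix.mul_inv_rev, transpose_nonsing_inv]
  · rw [hB, transpose_nonsing_inv, Matrix.mul_assoc, Matrix.mul_assoc, Matrix.mul_nonsing_inv _ hd,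
      Matrix.mul_one, Matrix.nonsing_inv_mul]
    rwa [det_transpose]

variable {n : Type*} [Fintype n] [DecidableEq n] {d N : ℕ} {Θ : Set (Fin d → ℝ)}
  {φ : (Fin d → ℝ) → n → ℂ} {hρ : ∀ η, (pureState (φ η)).PosSemidef} {θ : Fin d → ℝ}
  {w : Fin d → n → ℂ}

theorem exists_locallyUnbiased_of_mem (hd : 0 < d) (hφ : ∀ η, star (φ η) ⬝ᵥ φ η = 1)
    (hw : ∀ j a b, HasDerivAt (fun t : ℝ => pureState (φ (θ + t • Pi.single j 1)) a b)
      (tangent (φ θ) (w j) a b) 0) (horth : ∀ j, star (φ θ) ⬝ᵥ w j = 0)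
    {F : Matrix (Fin d) (Fin d) ℝ} (hF : ∀ i j, star (w i) ⬝ᵥ w j = (F i j : ℂ))
    {c : Matrix (Fin d) (Fin d) ℝ} (hc : cᵀ * ((N : ℝ) • F) * c = 1)
    (hΘ : ∀ a, frameEstimate θ c a ∈ Θ) :
    ∃ M : POVM Θ (Fin N → n), LocallyUnbiased Θ (fun η => pureState (φ η)) hρ N M θ ∧
      mse Θ (fun η => pureState (φ η)) hρ N M θ = c * cᵀ := by
  have hFs : Fᵀ = F := by
    ext i j
    have h : star (star (w i) ⬝ᵥ w j) = star (w j) ⬝ᵥ w i := (star_dotProduct _ _).symm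
    rw [hF, hF, RCLike.star_def, Complex.conj_ofReal] at h
    exact_mod_cast h.symm
  set Φ := productVector fun _ : Fin N => φ θ with hΦ
  set W := fun j => collectiveVector N (φ θ) (w j) with hW
  have hΦ1 : star Φ ⬝ᵥ Φ = 1 := star_productVector_dotProduct_self (hφ θ)
  have hΦW : ∀ j, star Φ ⬝ᵥ W j = 0 :=
    fun j => star_productVector_dotProduct_collectiveVector (horth j)
  have hWW : ∀ i j, star (W i) ⬝ᵥ W j = ((((N : ℝ) • F) i j : ℝ) : ℂ) := by
    intro i j
    rw [hW, star_collectiveVector_dotProduct (hφ θ) (horth j), hF]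
    simp
  -- The reality of the Gram matrix enters here: real combinations of the `W j` suffice for
  -- orthonormality, and the real matrix `c` also gives the estimates.
  set v := fun k => ∑ j, (c j k : ℂ) • W j with hv
  have hΦv : ∀ k, star Φ ⬝ᵥ v k = 0 := by
    intro k
    simp [hv, dotProduct_sum, hΦW]
  have hvv : ∀ k l, star (v k) ⬝ᵥ v l = if k = l then 1 else 0 := by
    intro k l
    have h := star_sum_smul_dotProduct_sum_smul hWW (fun j => c j k) (fun j => c j l)
    refine h.trans ?_
    have h2 : ((fun j => c j k) ⬝ᵥ ((N : ℝ) • F) *ᵥ fun j => c j l) =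
        (cᵀ * ((N : ℝ) • F) * c) k l := by
      rw [Matrix.mul_assoc]
      rfl
    rw [h2, hc, Matrix.one_apply]
    split_ifs <;> simp
  have hcc : c * cᵀ * ((N : ℝ) • F) = 1 := by
    rw [Matrix.mul_assoc]
    exact mul_eq_one_comm.1 hc
  let M : POVM Θ (Fin N → n) := POVM.ofFintype (frameEffect Φ v)
    (frameEffect_posSemidef hΦ1 hΦv hvv) (sum_frameEffect hd Φ v)
    (fun a => ⟨frameEstimate θ c a, hΘ a⟩)
  have hmean : ∀ i η, bias Θ (fun η => pureState (φ η)) hρ N M i η =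
      ∑ k, 2 * c i k * (tangent Φ (v k) * tensorPow N (pureState (φ η))).trace.re -
        (η i - θ i) := by
    intro i η
    have := isProbabilityMeasure_outcomeLaw (Θ := Θ) (hρ := hρ) (M := M) hφ η
    rw [← sum_frameEffect_mul_estimate Φ v hd θ c]
    have h : ∫ y : Θ, ((y : Fin d → ℝ) i - θ i)
        ∂(outcomeLaw Θ (fun η => pureState (φ η)) hρ N M η) = _ :=
      POVM.integral_born_ofFintype _ _
    have hi : Integrable (fun y : Θ => (y : Fin d → ℝ) i)
        (outcomeLaw Θ (fun η => pureState (φ η)) hρ N M η) :=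
      POVM.integrable_born_ofFintype _ _
    rw [← h, integral_sub hi (integrable_const _), bias,
      integral_const, probReal_univ, one_smul]
    ring
  refine ⟨M, ⟨.of_forall fun η i => POVM.integrable_born_ofFintype _ _,
    fun i => POVM.integrable_born_ofFintype _ _, fun i => ?_, fun i j => ?_⟩, ?_⟩
  · rw [hmean, sub_self, sub_zero]
    refine Finset.sum_eq_zero fun k _ => ?_
    rw [tensorPow_pureState, pureState, trace_mul_vecMulVec_star, ← hΦ,
      tangent_mulVec hΦ1 (hΦv k), dotProduct_smul, hΦv]
    simp
  · simp only [hmean]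
    have hθ : θ + (0 : ℝ) • (Pi.single j 1 : Fin d → ℝ) = θ := by simp
    have h1 : ∀ X : Matrix (Fin N → n) (Fin N → n) ℂ, HasDerivAt
        (fun t : ℝ => (X * tensorPow N (pureState (φ (θ + t • Pi.single j 1)))).trace.re)
        (X * tangent Φ (W j)).trace.re 0 := by
      intro X
      have h2 : ∀ x y, HasDerivAt
          (fun t : ℝ => tensorPow N (pureState (φ (θ + t • Pi.single j 1))) x y)
          (tangent Φ (W j) x y) 0 := by
        intro x y
        have := hasDerivAt_tensorPow (N := N) (φ := fun t : ℝ => φ (θ + t • Pi.single j 1))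
          (w := w j) (by simpa only [hθ] using hw j) x y
        simpa only [hθ] using this
      have h3 : HasDerivAt
          (fun t : ℝ => (X * tensorPow N (pureState (φ (θ + t • Pi.single j 1)))).trace)
          (X * tangent Φ (W j)).trace 0 := by
        simp only [Matrix.trace, Matrix.diag, Matrix.mul_apply]
        exact HasDerivAt.fun_sum fun x _ => HasDerivAt.fun_sum fun y _ =>
          (h2 y x).const_mul (X x y)
      exact Complex.reCLM.hasFDerivAt.comp_hasDerivAt 0 h3
    have h4 : HasDerivAt (fun t : ℝ => ∑ k, 2 * c i k *
          (tangent Φ (v k) * tensorPow N (pureState (φ (θ + t • Pi.single j 1)))).trace.re -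
          ((θ + t • (Pi.single j 1 : Fin d → ℝ)) i - θ i))
        (∑ k, 2 * c i k * (tangent Φ (v k) * tangent Φ (W j)).trace.re -
          (Pi.single j 1 : Fin d → ℝ) i) 0 := by
      refine (HasDerivAt.fun_sum fun k _ => (h1 (tangent Φ (v k))).const_mul _).sub ?_
      simpa using (hasDerivAt_id (0 : ℝ)).mul_const ((Pi.single j 1 : Fin d → ℝ) i)
    -- The response of the mean estimate to a shift of the parameter is `c cᵀ (N F) = 1`, which is
    -- local unbiasedness.
    have h5 : ∑ k, 2 * c i k * (tangent Φ (v k) * tangent Φ (W j)).trace.re -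
        (Pi.single j 1 : Fin d → ℝ) i = 0 := by
      have h6 : ∀ k, (tangent Φ (v k) * tangent Φ (W j)).trace.re =
          1 / 2 * (((N : ℝ) • F) * c) j k := by
        intro k
        rw [trace_mul_tangent_re (tangent_isHermitian _ _), tangent_mulVec hΦ1 (hΦv k),
          dotProduct_smul, hv, dotProduct_sum]
        simp only [dotProduct_smul, hWW, smul_eq_mul, Matrix.mul_apply]
        rw [show (1 / 2 : ℂ) = ((1 / 2 : ℝ) : ℂ) by norm_num, Complex.re_ofReal_mul,
          Complex.re_sum]
        congr 1
        refine Finset.sum_congr rfl fun l _ => ?_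
        rw [← Complex.ofReal_mul, Complex.ofReal_re, mul_comm]
      have h7 : ∑ k, 2 * c i k * (1 / 2 * (((N : ℝ) • F) * c) j k) =
          (c * cᵀ * ((N : ℝ) • F)) i j := by
        have h8 : c * cᵀ * ((N : ℝ) • F) = c * (((N : ℝ) • F) * c)ᵀ := by
          rw [transpose_mul, transpose_smul, hFs, Matrix.mul_assoc]
        rw [h8, Matrix.mul_apply]
        exact Finset.sum_congr rfl fun k _ => by rw [transpose_apply]; ring
      simp only [h6]
      rw [h7, hcc, Matrix.one_apply, Pi.single_apply, sub_self]
    rwa [h5] at h4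
  · ext i j
    rw [← sum_frameEffect_mul_estimate_mul hd hΦ1 hΦv θ c i j, mse, Matrix.of_apply, outcomeLaw,
      M.born_congr (tensorPow_pureState _) _ (pureState_posSemidef _)]
    exact POVM.integral_born_ofFintype _ _

end OptimalMeasurement

/-! ### Pure models with vanishing commutator matrix -/

section PureModel

variable {n : Type*} [Fintype n] {d : ℕ}

theorem trace_pureState_mul_mul {A : Matrix n n ℂ} (hA : A.IsHermitian) (B : Matrix n n ℂ)
    (φ : n → ℂ) : (pureState φ * (A * B)).trace = star (A *ᵥ φ) ⬝ᵥ B *ᵥ φ := by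
  rw [Matrix.trace_mul_comm, pureState, trace_mul_vecMulVec_star, star_mulVec, hA.eq,
    ← mulVec_mulVec, dotProduct_mulVec]

/-- The Gram matrix of the vectors `L j φ` has real part `F` and imaginary part `A`. -/
theorem star_mulVec_dotProduct_mulVec_eq_qfi {φ : n → ℂ} {L : Fin d → Matrix n n ℂ}
    (hL : ∀ i, (L i).IsHermitian) (hA : commutatorMatrix (pureState φ) L = 0) (i j : Fin d) :
    star (L i *ᵥ φ) ⬝ᵥ L j *ᵥ φ = (qfi (pureState φ) L i j : ℂ) := by
  have h1 : star (L i *ᵥ φ) ⬝ᵥ L j *ᵥ φ = star (L j *ᵥ φ) ⬝ᵥ L i *ᵥ φ := by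
    have h := congrFun (congrFun hA i) j
    rw [commutatorMatrix, Matrix.of_apply, mul_sub, trace_sub, trace_pureState_mul_mul (hL _),
      trace_pureState_mul_mul (hL _), Matrix.zero_apply] at h
    rcases mul_eq_zero.1 h with h | h
    · simp at h
    · exact sub_eq_zero.1 h
  have h2 : star (star (L i *ᵥ φ) ⬝ᵥ L j *ᵥ φ) = star (L i *ᵥ φ) ⬝ᵥ L j *ᵥ φ := by
    rw [← star_dotProduct, ← h1]
  obtain ⟨r, hr⟩ := Complex.conj_eq_iff_real.1 h2
  rw [qfi, Matrix.of_apply, mul_add, trace_add, trace_pureState_mul_mul (hL _),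
    trace_pureState_mul_mul (hL _), ← h1, hr]
  simp
  ring

variable {φ : (Fin d → ℝ) → n → ℂ} {θ : Fin d → ℝ} {L : Fin d → Matrix n n ℂ}

theorem IsSLD.hasDerivAt_pureState (hL : IsSLD (fun η => pureState (φ η)) θ L) (j : Fin d)
    (a b : n) : HasDerivAt (fun t : ℝ => pureState (φ (θ + t • Pi.single j 1)) a b)
      (tangent (φ θ) (L j *ᵥ φ θ) a b) 0 := by
  rw [← tangent_pureState_eq (hL j).1]
  exact (hL j).2 a b

/-- Differentiate `Tr ρ = 1`. -/
theorem IsSLD.star_dotProduct_mulVec_eq_zero (hφ : ∀ η, star (φ η) ⬝ᵥ φ η = 1)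
    (hL : IsSLD (fun η => pureState (φ η)) θ L) (j : Fin d) :
    star (φ θ) ⬝ᵥ L j *ᵥ φ θ = 0 := by
  have h1 : HasDerivAt (fun _ : ℝ => (1 : ℂ)) (tangent (φ θ) (L j *ᵥ φ θ)).trace 0 := by
    have h2 := HasDerivAt.fun_sum (u := Finset.univ) fun a _ => hL.hasDerivAt_pureState j a a
    refine h2.congr_of_eventuallyEq (.of_forall fun t => ?_)
    have : (pureState (φ (θ + t • Pi.single j 1))).trace = 1 := by
      rw [pureState, trace_vecMulVec, dotProduct_comm, hφ]
    exact this.symm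
  have h3 := h1.unique (hasDerivAt_const _ _)
  rw [tangent, trace_smul, trace_add, trace_vecMulVec, trace_vecMulVec,
    dotProduct_comm (L j *ᵥ φ θ), dotProduct_comm (φ θ), star_mulVec, (hL j).1.eq,
    ← dotProduct_mulVec, ← two_mul] at h3
  simpa using h3

variable [DecidableEq n] {N : ℕ} {Θ : Set (Fin d → ℝ)}
  {hρ : ∀ η, (pureState (φ η)).PosSemidef}

theorem one_le_figureOfMerit (hd : 0 < d) (hN : 0 < N) (hφ : ∀ η, star (φ η) ⬝ᵥ φ η = 1)
    (hL : IsSLD (fun η => pureState (φ η)) θ L)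
    (hA : commutatorMatrix (pureState (φ θ)) L = 0) (hF : (qfi (pureState (φ θ)) L).PosDef) :
    1 ≤ figureOfMerit Θ (fun η => pureState (φ η)) hρ L N θ := by
  set F := qfi (pureState (φ θ)) L with hFdef
  have hN' : (N : ℝ) ≠ 0 := by positivity
  refine le_iInf₂ fun M hM => ?_
  let u : Fin d → ℝ := Pi.single ⟨0, hd⟩ 1
  have hu : u ≠ 0 := by simp [u]
  have hpos : 0 < u ⬝ᵥ F⁻¹ *ᵥ u := by simpa using hF.inv.dotProduct_mulVec_pos hu
  have htr : ∀ X : Matrix (Fin d) (Fin d) ℝ, (vecMulVec u u * X).trace = u ⬝ᵥ X *ᵥ u := by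
    intro X
    rw [vecMulVec_mul, trace_vecMulVec, dotProduct_comm, ← dotProduct_mulVec]
  have hG : (vecMulVec u u).PosSemidef ∧ vecMulVec u u ≠ 0 := by
    refine ⟨by simpa using Matrix.posSemidef_vecMulVec_self_star u, fun h => ?_⟩
    have := congrFun (congrFun h ⟨0, hd⟩) ⟨0, hd⟩
    simp [vecMulVec_apply, u] at this
  refine le_trans ?_ (le_iSup₂ (f := fun G (_ : G.PosSemidef ∧ G ≠ 0) =>
    (((N * (G * mse Θ (fun η => pureState (φ η)) hρ N M θ).trace) / (G * F⁻¹).trace : ℝ) :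
      EReal)) _ hG)
  rw [← EReal.coe_one, EReal.coe_le_coe_iff, htr, htr, one_le_div hpos]
  -- The vector `F⁻¹ u / N` maximises `2 u · v - N v · F v`.
  have h := hM.two_mul_dotProduct_le hφ hL.hasDerivAt_pureState
    (hL.star_dotProduct_mulVec_eq_zero hφ)
    (star_mulVec_dotProduct_mulVec_eq_qfi (fun i => (hL i).1) hA) u ((1 / N : ℝ) • F⁻¹ *ᵥ u)
  have hFF : F *ᵥ F⁻¹ *ᵥ u = u := by
    rw [mulVec_mulVec, Matrix.mul_nonsing_inv _ ((Matrix.isUnit_iff_isUnit_det F).1 hF.isUnit),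
      one_mulVec]
  rw [← hFdef, mulVec_smul, hFF, dotProduct_smul, smul_dotProduct, dotProduct_smul,
    dotProduct_comm (F⁻¹ *ᵥ u) u, smul_eq_mul, smul_eq_mul] at h
  field_simp at h
  linarith

theorem figureOfMerit_le_one_of_mse_eq {M : POVM Θ (Fin N → n)} {ρ : (Fin d → ℝ) → Matrix n n ℂ}
    {hρ : ∀ η, (ρ η).PosSemidef} (hM : LocallyUnbiased Θ ρ hρ N M θ)
    (hmse : (N : ℝ) • mse Θ ρ hρ N M θ = (qfi (ρ θ) L)⁻¹) :
    figureOfMerit Θ ρ hρ L N θ ≤ 1 := by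
  refine (iInf₂_le M hM).trans (iSup₂_le fun G _ => ?_)
  rw [← hmse, mul_smul_comm, trace_smul, smul_eq_mul, ← EReal.coe_one, EReal.coe_le_coe_iff]
  -- The quotient is `x / x`, which is `0` when `x = 0`, so no positivity of the denominator is
  -- needed.
  exact div_self_le_one _

theorem tendsto_frameEstimate (C : Matrix (Fin d) (Fin d) ℝ) (θ : Fin d → ℝ)
    (a : Option (Fin d × Bool)) :
    Tendsto (fun N : ℕ => frameEstimate θ ((√N)⁻¹ • C) a) atTop (𝓝 θ) := by
  rcases a with _ | ⟨k, s⟩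
  · exact tendsto_const_nhds
  · refine tendsto_pi_nhds.2 fun i => ?_
    have h : Tendsto (fun N : ℕ => (√(N : ℝ))⁻¹) atTop (𝓝 0) :=
      (Real.tendsto_sqrt_atTop.comp tendsto_natCast_atTop_atTop).inv_tendsto_atTop
    simpa [frameEstimate] using
      ((h.mul_const (C i k)).const_mul ((if s then 1 else -1) * √(d : ℝ))).const_add (θ i)

theorem eventually_figureOfMerit_le_one (hd : 0 < d) (hΘ : Θ ∈ 𝓝 θ)
    (hφ : ∀ η, star (φ η) ⬝ᵥ φ η = 1) (hL : IsSLD (fun η => pureState (φ η)) θ L)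
    (hA : commutatorMatrix (pureState (φ θ)) L = 0) (hF : (qfi (pureState (φ θ)) L).PosDef) :
    ∀ᶠ N : ℕ in atTop, figureOfMerit Θ (fun η => pureState (φ η)) hρ L N θ ≤ 1 := by
  obtain ⟨C, hC, hC'⟩ := exists_mul_transpose_eq_inv hF
  have h1 : ∀ᶠ N : ℕ in atTop, ∀ a, frameEstimate θ ((√N)⁻¹ • C) a ∈ Θ :=
    eventually_all.2 fun a => tendsto_frameEstimate C θ a hΘ
  filter_upwards [h1, eventually_gt_atTop 0] with N hN hN0
  have hN' : (N : ℝ) ≠ 0 := by positivity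
  have hs : (N : ℝ) * (√(N : ℝ))⁻¹ * (√(N : ℝ))⁻¹ = 1 := by
    rw [mul_assoc, ← mul_inv, Real.mul_self_sqrt (Nat.cast_nonneg N), mul_inv_cancel₀ hN']
  obtain ⟨M, hM, hmse⟩ := exists_locallyUnbiased_of_mem (N := N) (hρ := hρ) hd hφ hL.hasDerivAt_pureState
    (hL.star_dotProduct_mulVec_eq_zero hφ)
    (star_mulVec_dotProduct_mulVec_eq_qfi (fun i => (hL i).1) hA)
    (c := (√N)⁻¹ • C) (by
      rw [transpose_smul, Matrix.smul_mul, Matrix.mul_smul, Matrix.mul_smul, Matrix.smul_mul,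
        smul_smul, Matrix.smul_mul, smul_smul, hC', mul_comm _ (N : ℝ), ← mul_assoc, hs,
        one_smul]) hN
  refine figureOfMerit_le_one_of_mse_eq hM ?_
  rw [hmse, transpose_smul, Matrix.smul_mul, Matrix.mul_smul, smul_smul, smul_smul, hs,
    one_smul, hC]

theorem incompatibility_eq_zero (hd : 0 < d) (hΘ : Θ ∈ 𝓝 θ)
    (hφ : ∀ η, star (φ η) ⬝ᵥ φ η = 1) (hL : IsSLD (fun η => pureState (φ η)) θ L)
    (hA : commutatorMatrix (pureState (φ θ)) L = 0) (hF : (qfi (pureState (φ θ)) L).PosDef) :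
    incompatibility Θ (fun η => pureState (φ η)) hρ L θ = 0 := by
  have h : (fun N : ℕ => figureOfMerit Θ (fun η => pureState (φ η)) hρ L N θ)
      =ᶠ[atTop] fun _ => (1 : EReal) := by
    filter_upwards [eventually_figureOfMerit_le_one (hρ := hρ) hd hΘ hφ hL hA hF,
      eventually_gt_atTop 0] with N h1 hN
    exact le_antisymm h1 (one_le_figureOfMerit hd hN hφ hL hA hF)
  rw [incompatibility, liminf_congr h, liminf_const]
  exact EReal.sub_self (by decide) (by decide)

end PureModel

/-! ### Logarithmic derivatives from derivative vectors -/

section Derivatives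

variable {n : Type*} [Fintype n] {d : ℕ} {φ : (Fin d → ℝ) → n → ℂ} {θ : Fin d → ℝ}
  {g : Fin d → n → ℂ}

theorem hasDerivAt_pureState {n : Type*} {φ : ℝ → n → ℂ} {φ' : n → ℂ}
    (h : ∀ a, HasDerivAt (fun t => φ t a) (φ' a) 0) (a b : n) :
    HasDerivAt (fun t => pureState (φ t) a b) (tangent (φ 0) ((2 : ℂ) • φ') a b) 0 := by
  have e : tangent (φ 0) ((2 : ℂ) • φ') a b = φ' a * star (φ 0 b) + φ 0 a * star (φ' b) := by
    simp [tangent, vecMulVec_apply]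
    ring
  rw [e]
  exact (h a).mul (h b).star

theorem tangent_add_smul_self {n : Type*} (φ g : n → ℂ) {z : ℂ} (hz : star z = -z) :
    tangent φ (g + z • φ) = tangent φ g := by
  ext a b
  simp only [tangent, Matrix.smul_apply, Matrix.add_apply, vecMulVec_apply, Pi.add_apply,
    Pi.star_apply, Pi.smul_apply, star_add, star_smul, smul_eq_mul, hz]
  ring

theorem tangent_mulVec_self {φ : n → ℂ} (hφ : star φ ⬝ᵥ φ = 1) (g : n → ℂ) :
    tangent φ g *ᵥ φ = (1 / 2 : ℂ) • (g + (star g ⬝ᵥ φ) • φ) := by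
  rw [tangent, smul_mulVec, add_mulVec, vecMulVec_mulVec, vecMulVec_mulVec, hφ]
  simp [add_comm]

/-- For a pure state `2 ∂ρ` is a logarithmic derivative, as differentiating `ρ² = ρ` shows. The
extra imaginary multiple of `φ` is a change of phase, invisible to `tangent`. -/
theorem isSLD_two_smul_tangent (hφ : star (φ θ) ⬝ᵥ φ θ = 1)
    (hg : ∀ j a b, HasDerivAt (fun t : ℝ => pureState (φ (θ + t • Pi.single j 1)) a b)
      (tangent (φ θ) (g j) a b) 0)
    (hgφ : ∀ j, star (star (g j) ⬝ᵥ φ θ) = -(star (g j) ⬝ᵥ φ θ)) :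
    IsSLD (fun η => pureState (φ η)) θ fun j => (2 : ℝ) • tangent (φ θ) (g j) := by
  intro j
  have hH : ((2 : ℝ) • tangent (φ θ) (g j)).IsHermitian :=
    (tangent_isHermitian _ _).smul (by simp)
  refine ⟨hH, fun a b => ?_⟩
  have e : ((2 : ℝ) • tangent (φ θ) (g j)) *ᵥ φ θ = g j + (star (g j) ⬝ᵥ φ θ) • φ θ := by
    rw [smul_mulVec, tangent_mulVec_self hφ]
    ext a
    simp
  simp only [tangent_pureState_eq hH, e]
  rw [tangent_add_smul_self _ _ (hgφ j)]
  exact hg j a b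

/-- Logarithmic derivatives are not unique, but `∂ρ` determines `L j φ`. Its Gram matrix differs
from that of `g` by `⟨φ, g i⟩ ⟨φ, g j⟩`, which is symmetric in `i` and `j`. -/
theorem commutatorMatrix_eq_zero (hφ : ∀ η, star (φ η) ⬝ᵥ φ η = 1)
    (hg : ∀ j a b, HasDerivAt (fun t : ℝ => pureState (φ (θ + t • Pi.single j 1)) a b)
      (tangent (φ θ) (g j) a b) 0)
    (hgg : ∀ i j, star (g i) ⬝ᵥ g j = star (g j) ⬝ᵥ g i)
    {L : Fin d → Matrix n n ℂ} (hL : IsSLD (fun η => pureState (φ η)) θ L) :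
    commutatorMatrix (pureState (φ θ)) L = 0 := by
  have hw : ∀ j, L j *ᵥ φ θ = g j + (star (g j) ⬝ᵥ φ θ) • φ θ := by
    intro j
    have h1 : tangent (φ θ) (L j *ᵥ φ θ) = tangent (φ θ) (g j) := by
      ext a b
      exact (hL.hasDerivAt_pureState j a b).unique (hg j a b)
    have h2 := congrArg (fun X => (2 : ℂ) • X *ᵥ φ θ) h1
    simpa [tangent_mulVec (hφ θ) (hL.star_dotProduct_mulVec_eq_zero hφ j),
      tangent_mulVec_self (hφ θ)] using h2
  have hww : ∀ i j, star (L i *ᵥ φ θ) ⬝ᵥ L j *ᵥ φ θ =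
      star (g i) ⬝ᵥ g j + (star (φ θ) ⬝ᵥ g i) * (star (φ θ) ⬝ᵥ g j) := by
    intro i j
    have h1 : star (L i *ᵥ φ θ) ⬝ᵥ φ θ = 0 := by
      rw [star_dotProduct, hL.star_dotProduct_mulVec_eq_zero hφ, star_zero]
    rw [hw j, dotProduct_add, dotProduct_smul, h1, smul_zero, add_zero, hw i, star_add, star_smul,
      add_dotProduct, smul_dotProduct, ← star_dotProduct, smul_eq_mul]
  ext i j
  rw [commutatorMatrix, Matrix.of_apply, mul_sub, trace_sub, trace_pureState_mul_mul (hL i).1,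
    trace_pureState_mul_mul (hL j).1, hww, hww, hgg i j, mul_comm (star (φ θ) ⬝ᵥ g i)]
  simp

end Derivatives

/-! ### Derivatives of the unitary encoding -/

section Encoding

variable {d D : ℕ} {H : Fin d → Matrix (Fin D) (Fin D) ℂ}

theorem unitaryEncoding_conjTranspose_mul_self (hH : ∀ j, (H j).IsHermitian) (η : Fin d → ℝ) :
    (unitaryEncoding H η)ᴴ * unitaryEncoding H η = 1 := by
  have h : (Complex.I • ∑ j, (η j : ℂ) • H j)ᴴ = -(Complex.I • ∑ j, (η j : ℂ) • H j) := by
    rw [conjTranspose_smul, conjTranspose_sum]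
    simp only [conjTranspose_smul, (hH _).eq, RCLike.star_def, Complex.conj_ofReal,
      Complex.conj_I, neg_smul]
  rw [unitaryEncoding, ← Matrix.exp_conjTranspose, h, Matrix.exp_neg]
  exact Matrix.nonsing_inv_mul _ ((Matrix.isUnit_iff_isUnit_det _).1 (Matrix.isUnit_exp _))

theorem exists_hasDerivAt_unitaryEncoding (θ : Fin d → ℝ) (j : Fin d) :
    ∃ U' : Matrix (Fin D) (Fin D) ℂ, ∀ a b, HasDerivAt
      (fun t : ℝ => unitaryEncoding H (θ + t • Pi.single j 1) a b) (U' a b) 0 := by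
  let _ : NormedRing (Matrix (Fin D) (Fin D) ℂ) := Matrix.linftyOpNormedRing
  let _ : NormedAlgebra ℝ (Matrix (Fin D) (Fin D) ℂ) := Matrix.linftyOpNormedAlgebra
  have e : (fun t : ℝ => Complex.I •
      ∑ l, (((θ + t • (Pi.single j 1 : Fin d → ℝ)) l : ℝ) : ℂ) • H l) =
        fun t : ℝ => Complex.I • ∑ l, (θ l : ℂ) • H l + t • (Complex.I • H j) := by
    funext t
    have h : ∑ l, ((t * (Pi.single j 1 : Fin d → ℝ) l : ℝ) : ℂ) • H l = (t : ℂ) • H j := by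
      rw [Finset.sum_eq_single j (fun l _ hl => by simp [hl]) (by simp)]
      simp
    simp only [Pi.add_apply, Pi.smul_apply, smul_eq_mul, Complex.ofReal_add, add_smul,
      Finset.sum_add_distrib, h, smul_add]
    rw [smul_comm, Complex.coe_smul]
  have hX : DifferentiableAt ℝ (fun t : ℝ => Complex.I •
      ∑ l, (((θ + t • (Pi.single j 1 : Fin d → ℝ)) l : ℝ) : ℂ) • H l) 0 := by
    rw [e]
    exact (differentiableAt_const _).add (differentiableAt_id.smul_const _)
  have hU : DifferentiableAt ℝ (fun t : ℝ => unitaryEncoding H (θ + t • Pi.single j 1)) 0 :=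
    (NormedSpace.exp_analytic (𝕂 := ℝ) _).differentiableAt.comp (0 : ℝ) hX
  refine ⟨deriv (fun t : ℝ => unitaryEncoding H (θ + t • Pi.single j 1)) 0, fun a b => ?_⟩
  exact (LinearMap.toContinuousLinearMap
    (Matrix.entryLinearMap ℝ ℂ a b)).hasFDerivAt.comp_hasDerivAt 0 hU.hasDerivAt

/-- The `H j` need not commute, so the generator is in general not `H j`. Differentiability of the
exponential and of `Uᴴ U = 1` makes `K = -i Uᴴ U'` Hermitian, and no formula for it is needed. -/
theorem exists_isHermitian_hasDerivAt_unitaryEncoding (hH : ∀ j, (H j).IsHermitian)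
    (θ : Fin d → ℝ) (j : Fin d) :
    ∃ K : Matrix (Fin D) (Fin D) ℂ, K.IsHermitian ∧ ∀ a b, HasDerivAt
      (fun t : ℝ => unitaryEncoding H (θ + t • Pi.single j 1) a b)
      ((Complex.I • (unitaryEncoding H θ * K)) a b) 0 := by
  obtain ⟨U', hU'⟩ := exists_hasDerivAt_unitaryEncoding (H := H) θ j
  set U := unitaryEncoding H θ with hU
  have hUU : Uᴴ * U = 1 := unitaryEncoding_conjTranspose_mul_self hH θ
  have hθ : θ + (0 : ℝ) • (Pi.single j 1 : Fin d → ℝ) = θ := by simp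
  have h0 : U'ᴴ * U + Uᴴ * U' = 0 := by
    ext a b
    have h1 := HasDerivAt.fun_sum (u := Finset.univ) fun k _ => (hU' k a).star.mul (hU' k b)
    have h2 : HasDerivAt (fun _ : ℝ => (1 : Matrix (Fin D) (Fin D) ℂ) a b) _ 0 :=
      h1.congr_of_eventuallyEq (.of_forall fun t => by
        rw [← unitaryEncoding_conjTranspose_mul_self hH (θ + t • Pi.single j 1)]
        rfl)
    have h3 := h2.unique (hasDerivAt_const _ _)
    rw [Finset.sum_add_distrib, hθ] at h3
    exact h3
  refine ⟨-Complex.I • (Uᴴ * U'), ?_, fun a b => ?_⟩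
  · rw [Matrix.IsHermitian, conjTranspose_smul, conjTranspose_mul, conjTranspose_conjTranspose,
      eq_neg_of_add_eq_zero_left h0]
    simp
  · have e : Complex.I • (U * (-Complex.I • (Uᴴ * U'))) = U' := by
      rw [Matrix.mul_smul, ← Matrix.mul_assoc, mul_eq_one_comm.1 hUU, Matrix.one_mul, smul_smul]
      simp
    rw [e]
    exact hU' a b

end Encoding

/-! ### Expectations in a maximally entangled vector -/

section MaximallyEntangled

variable {D : ℕ} {ψ : Fin D × Fin D → ℂ}

theorem conjTranspose_mul_self_of_orthonormalBasis
    (e : OrthonormalBasis (Fin D) ℂ (EuclideanSpace ℂ (Fin D))) :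
    (Matrix.of fun a i => e i a)ᴴ * (Matrix.of fun a i => e i a) = 1 := by
  ext i j
  rw [Matrix.mul_apply, Matrix.one_apply, ← orthonormal_iff_ite.1 e.orthonormal i j,
    PiLp.inner_apply]
  simp [mul_comm]

/-- The coefficient matrix is a unitary divided by `√D`; the two products encode the maximally mixed
reduced states. -/
theorem IsMaximallyEntangled.exists_eq_vec (hψ : IsMaximallyEntangled ψ) :
    ∃ Q : Matrix (Fin D) (Fin D) ℂ, ψ = vec Q ∧ Qᴴ * Q = (1 / D : ℂ) • 1 ∧
      Q * Qᴴ = (1 / D : ℂ) • 1 := by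
  obtain ⟨e, f, h⟩ := hψ
  set E : Matrix (Fin D) (Fin D) ℂ := Matrix.of fun a i => e i a with hE
  set F : Matrix (Fin D) (Fin D) ℂ := Matrix.of fun a i => f i a with hF
  have hEE : Eᴴ * E = 1 := conjTranspose_mul_self_of_orthonormalBasis e
  have hFF : Fᴴ * F = 1 := conjTranspose_mul_self_of_orthonormalBasis f
  have hE' : (Eᵀ)ᴴ * Eᵀ = 1 := by
    rw [show Eᵀᴴ = Eᴴᵀ from rfl, ← transpose_mul, mul_eq_one_comm.1 hEE, transpose_one]
  have hs : star (1 / (√D : ℂ)) * (1 / (√D : ℂ)) = 1 / D := by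
    rw [star_div₀, star_one, RCLike.star_def, Complex.conj_ofReal, div_mul_div_comm,
      ← Complex.ofReal_mul, Real.mul_self_sqrt (Nat.cast_nonneg D)]
    simp
  refine ⟨(1 / (√D : ℂ)) • (F * Eᵀ), ?_, ?_, ?_⟩
  · ext ⟨a, b⟩
    rw [h]
    simp [vec, Matrix.mul_apply, E, F, mul_comm]
  · rw [conjTranspose_smul, Matrix.smul_mul, Matrix.mul_smul, smul_smul, hs, conjTranspose_mul,
      Matrix.mul_assoc, ← Matrix.mul_assoc Fᴴ, hFF, Matrix.one_mul, hE']
  · rw [conjTranspose_smul, Matrix.smul_mul, Matrix.mul_smul, smul_smul, mul_comm, hs,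
      conjTranspose_mul, Matrix.mul_assoc, ← Matrix.mul_assoc Eᵀ, mul_eq_one_comm.1 hE',
      Matrix.one_mul, mul_eq_one_comm.1 hFF]

theorem IsMaximallyEntangled.star_dotProduct_kronecker_one_mulVec (hψ : IsMaximallyEntangled ψ)
    (A : Matrix (Fin D) (Fin D) ℂ) :
    star ψ ⬝ᵥ (A ⊗ₖ (1 : Matrix (Fin D) (Fin D) ℂ)) *ᵥ ψ = 1 / D * A.trace := by
  obtain ⟨Q, rfl, hQ, -⟩ := hψ.exists_eq_vec
  rw [kronecker_mulVec_vec, star_vec_dotProduct_vec, Matrix.one_mul, ← Matrix.mul_assoc, hQ,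
    Matrix.smul_mul, Matrix.one_mul, trace_smul, trace_transpose, smul_eq_mul]

theorem IsMaximallyEntangled.star_dotProduct_one_kronecker_mulVec (hψ : IsMaximallyEntangled ψ)
    (B : Matrix (Fin D) (Fin D) ℂ) :
    star ψ ⬝ᵥ ((1 : Matrix (Fin D) (Fin D) ℂ) ⊗ₖ B) *ᵥ ψ = 1 / D * B.trace := by
  obtain ⟨Q, rfl, -, hQ⟩ := hψ.exists_eq_vec
  rw [kronecker_mulVec_vec, star_vec_dotProduct_vec, transpose_one, Matrix.mul_one,
    Matrix.trace_mul_comm, Matrix.mul_assoc, hQ, Matrix.mul_smul, Matrix.mul_one, trace_smul,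
    smul_eq_mul]

theorem IsMaximallyEntangled.star_dotProduct_self (hψ : IsMaximallyEntangled ψ) (hD : D ≠ 0) :
    star ψ ⬝ᵥ ψ = 1 := by
  have h := hψ.star_dotProduct_kronecker_one_mulVec 1
  rw [one_kronecker_one, one_mulVec] at h
  rw [h, trace_one, Fintype.card_fin, one_div_mul_cancel (by exact_mod_cast hD)]

/-- The local generator `A ⊗ 1 + 1 ⊗ B`. -/
def localSum (A B : Matrix (Fin D) (Fin D) ℂ) : Matrix (Fin D × Fin D) (Fin D × Fin D) ℂ :=
  A ⊗ₖ (1 : Matrix (Fin D) (Fin D) ℂ) + (1 : Matrix (Fin D) (Fin D) ℂ) ⊗ₖ B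

theorem localSum_isHermitian {A B : Matrix (Fin D) (Fin D) ℂ} (hA : A.IsHermitian)
    (hB : B.IsHermitian) : (localSum A B).IsHermitian := by
  rw [Matrix.IsHermitian, localSum, conjTranspose_add, conjTranspose_kronecker,
    conjTranspose_kronecker, hA.eq, hB.eq, conjTranspose_one]

/-- Exchanging the factors permutes the cross terms `A ⊗ B'` and `A' ⊗ B`; the other terms are
traces, which are cyclic. -/
theorem IsMaximallyEntangled.star_dotProduct_localSum_mul_mulVec_comm
    (hψ : IsMaximallyEntangled ψ) (A B A' B' : Matrix (Fin D) (Fin D) ℂ) :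
    star ψ ⬝ᵥ (localSum A B * localSum A' B') *ᵥ ψ =
      star ψ ⬝ᵥ (localSum A' B' * localSum A B) *ᵥ ψ := by
  simp only [localSum, mul_add, add_mul, ← mul_kronecker_mul, Matrix.one_mul, Matrix.mul_one,
    add_mulVec, dotProduct_add, hψ.star_dotProduct_kronecker_one_mulVec,
    hψ.star_dotProduct_one_kronecker_mulVec, Matrix.trace_mul_comm A' A,
    Matrix.trace_mul_comm B' B]
  ring

end MaximallyEntangled

/-! ### The two evolutions -/

section Main

variable {d D : ℕ} {H : Fin d → Matrix (Fin D) (Fin D) ℂ}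
  {W : (Fin d → ℝ) → Matrix (Fin D × Fin D) (Fin D × Fin D) ℂ}

theorem kronecker_conjTranspose_mul_self {A B : Matrix (Fin D) (Fin D) ℂ} (hA : Aᴴ * A = 1)
    (hB : Bᴴ * B = 1) : (A ⊗ₖ B)ᴴ * (A ⊗ₖ B) = 1 := by
  rw [conjTranspose_kronecker, ← mul_kronecker_mul, hA, hB, one_kronecker_one]

theorem conjTranspose_mul_self_of_eq_or (hH : ∀ j, (H j).IsHermitian)
    (hW : (W = fun θ => (1 : Matrix (Fin D) (Fin D) ℂ) ⊗ₖ unitaryEncoding H θ) ∨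
      (W = fun θ => unitaryEncoding H θ ⊗ₖ unitaryEncoding H θ)) (η : Fin d → ℝ) :
    (W η)ᴴ * W η = 1 := by
  rcases hW with rfl | rfl
  · exact kronecker_conjTranspose_mul_self (by simp)
      (unitaryEncoding_conjTranspose_mul_self hH η)
  · exact kronecker_conjTranspose_mul_self (unitaryEncoding_conjTranspose_mul_self hH η)
      (unitaryEncoding_conjTranspose_mul_self hH η)

theorem exists_localSum_hasDerivAt (hH : ∀ j, (H j).IsHermitian)
    (hW : (W = fun θ => (1 : Matrix (Fin D) (Fin D) ℂ) ⊗ₖ unitaryEncoding H θ) ∨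
      (W = fun θ => unitaryEncoding H θ ⊗ₖ unitaryEncoding H θ)) (θ : Fin d → ℝ) (j : Fin d) :
    ∃ A B : Matrix (Fin D) (Fin D) ℂ, A.IsHermitian ∧ B.IsHermitian ∧ ∀ x y, HasDerivAt
      (fun t : ℝ => W (θ + t • Pi.single j 1) x y)
      ((Complex.I • (W θ * localSum A B)) x y) 0 := by
  obtain ⟨K, hK, hU⟩ := exists_isHermitian_hasDerivAt_unitaryEncoding hH θ j
  have hθ : θ + (0 : ℝ) • (Pi.single j 1 : Fin d → ℝ) = θ := by simp
  rcases hW with rfl | rfl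
  · refine ⟨0, K, isHermitian_zero, hK, fun x y => ?_⟩
    have e : Complex.I • (((1 : Matrix (Fin D) (Fin D) ℂ) ⊗ₖ unitaryEncoding H θ) * localSum 0 K) =
        (1 : Matrix (Fin D) (Fin D) ℂ) ⊗ₖ (Complex.I • (unitaryEncoding H θ * K)) := by
      rw [localSum, zero_kronecker, zero_add, ← mul_kronecker_mul, Matrix.one_mul,
        kronecker_smul]
    rw [e]
    exact (hU x.2 y.2).const_mul _
  · refine ⟨K, K, hK, hK, fun x y => ?_⟩
    have e : Complex.I • ((unitaryEncoding H θ ⊗ₖ unitaryEncoding H θ) * localSum K K) =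
        (Complex.I • (unitaryEncoding H θ * K)) ⊗ₖ unitaryEncoding H θ +
          unitaryEncoding H θ ⊗ₖ (Complex.I • (unitaryEncoding H θ * K)) := by
      rw [localSum, mul_add, ← mul_kronecker_mul, ← mul_kronecker_mul, Matrix.mul_one,
        kronecker_smul, smul_kronecker, smul_add]
    rw [e]
    have h := (hU x.1 y.1).mul (hU x.2 y.2)
    rw [hθ] at h
    exact h

theorem exists_derivative_vectors (hD : D ≠ 0) (hH : ∀ j, (H j).IsHermitian)
    (hW : (W = fun θ => (1 : Matrix (Fin D) (Fin D) ℂ) ⊗ₖ unitaryEncoding H θ) ∨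
      (W = fun θ => unitaryEncoding H θ ⊗ₖ unitaryEncoding H θ))
    {ψ : Fin D × Fin D → ℂ} (hψ : IsMaximallyEntangled ψ) (θ : Fin d → ℝ) :
    (∀ η, star (W η *ᵥ ψ) ⬝ᵥ (W η *ᵥ ψ) = 1) ∧ ∃ g : Fin d → Fin D × Fin D → ℂ,
      (∀ j a b, HasDerivAt
        (fun t : ℝ => pureState (W (θ + t • Pi.single j 1) *ᵥ ψ) a b)
        (tangent (W θ *ᵥ ψ) (g j) a b) 0) ∧
      (∀ i j, star (g i) ⬝ᵥ g j = star (g j) ⬝ᵥ g i) ∧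
      ∀ j, star (star (g j) ⬝ᵥ (W θ *ᵥ ψ)) = -(star (g j) ⬝ᵥ (W θ *ᵥ ψ)) := by
  have hU := conjTranspose_mul_self_of_eq_or hH hW
  have hinner : ∀ η u v, star (W η *ᵥ u) ⬝ᵥ (W η *ᵥ v) = star u ⬝ᵥ v := by
    intro η u v
    rw [star_mulVec, ← dotProduct_mulVec, mulVec_mulVec, hU, one_mulVec]
  refine ⟨fun η => by rw [hinner, hψ.star_dotProduct_self hD], ?_⟩
  choose A B hA hB hder using exists_localSum_hasDerivAt hH hW θ
  have hG := fun j => localSum_isHermitian (hA j) (hB j)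
  -- Twice the derivative of the state vector; the `2` offsets the `1 / 2` in `tangent`.
  refine ⟨fun j => (2 : ℂ) • Complex.I • (W θ *ᵥ localSum (A j) (B j) *ᵥ ψ), ?_, ?_, ?_⟩
  · intro j
    have hθ : θ + (0 : ℝ) • (Pi.single j 1 : Fin d → ℝ) = θ := by simp
    have h := hasDerivAt_pureState (φ := fun t : ℝ => W (θ + t • Pi.single j 1) *ᵥ ψ)
      (φ' := Complex.I • (W θ *ᵥ localSum (A j) (B j) *ᵥ ψ)) (fun a => by
        rw [mulVec_mulVec, ← smul_mulVec]
        exact HasDerivAt.fun_sum fun b _ => (hder j a b).mul_const _)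
    simpa only [hθ] using h
  · intro i j
    have h := hψ.star_dotProduct_localSum_mul_mulVec_comm (A i) (B i) (A j) (B j)
    rw [← mulVec_mulVec, ← mulVec_mulVec] at h
    simp only [star_smul, smul_dotProduct, dotProduct_smul, hinner]
    rw [star_mulVec, star_mulVec, (hG i).eq, (hG j).eq, ← dotProduct_mulVec, ← dotProduct_mulVec, h]
  · intro j
    have h := star_dotProduct_mulVec (hG j) ψ ψ
    have h' : star (localSum (A j) (B j) *ᵥ ψ) ⬝ᵥ ψ = star ψ ⬝ᵥ localSum (A j) (B j) *ᵥ ψ := by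
      rw [star_mulVec, (hG j).eq, ← dotProduct_mulVec]
    simp only [star_smul, smul_dotProduct, hinner, h', smul_eq_mul, star_mul', ← h]
    simp

end Main

end QEstimation

theorem mainTheorem6 {d D : ℕ} (hd : 0 < d)
    (H : Fin d → Matrix (Fin D) (Fin D) ℂ) (hH : ∀ j, (H j).IsHermitian)
    (ψ : Fin D × Fin D → ℂ) (hψ : QEstimation.IsMaximallyEntangled ψ)
    (W : (Fin d → ℝ) → Matrix (Fin D × Fin D) (Fin D × Fin D) ℂ)
    (hW : (W = fun θ => (1 : Matrix (Fin D) (Fin D) ℂ) ⊗ₖ QEstimation.unitaryEncoding H θ) ∨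
      (W = fun θ => QEstimation.unitaryEncoding H θ ⊗ₖ QEstimation.unitaryEncoding H θ))
    (Θ : Set (Fin d → ℝ)) (hΘ : IsOpen Θ) (θ : Fin d → ℝ) (hθ : θ ∈ Θ) :
    (∃ L, QEstimation.IsSLD (fun η => QEstimation.pureState (W η *ᵥ ψ)) θ L) ∧
      ∀ L, QEstimation.IsSLD (fun η => QEstimation.pureState (W η *ᵥ ψ)) θ L →
        QEstimation.commutatorMatrix (QEstimation.pureState (W θ *ᵥ ψ)) L = 0 ∧
        ((QEstimation.qfi (QEstimation.pureState (W θ *ᵥ ψ)) L).PosDef →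
          QEstimation.incompatibility Θ (fun η => QEstimation.pureState (W η *ᵥ ψ))
            (fun η => QEstimation.pureState_posSemidef (W η *ᵥ ψ)) L θ = 0) := by
  -- For `D = 0` the vector is empty and cannot be normalised; then `F = 0` is not positive definite
  -- because `0 < d`.
  rcases eq_or_ne D 0 with rfl | hD
  · refine ⟨⟨fun _ => 0, fun i => ⟨isHermitian_zero, fun a => a.1.elim0⟩⟩, fun L _ => ⟨?_, ?_⟩⟩
    · ext i j
      simp [QEstimation.commutatorMatrix, Matrix.trace]
    · intro hF
      have h := hF.diag_pos (i := ⟨0, hd⟩)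
      simp [QEstimation.qfi, Matrix.trace] at h
  · obtain ⟨hφ, g, hg, hgg, hgφ⟩ := QEstimation.exists_derivative_vectors hD hH hW hψ θ
    refine ⟨⟨_, QEstimation.isSLD_two_smul_tangent (φ := fun η => W η *ᵥ ψ) (hφ θ) hg hgφ⟩,
      fun L hL => ?_⟩
    have hA := QEstimation.commutatorMatrix_eq_zero (φ := fun η => W η *ᵥ ψ) hφ hg hgg hL
    exact ⟨hA, QEstimation.incompatibility_eq_zero (φ := fun η => W η *ᵥ ψ) hd
      (hΘ.mem_nhds hθ) hφ hL hA⟩
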